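/- **Theorem 4.1 (Oracle properties).** Fix $p\ge 0$, $K\ge 1$ and levels $0<\tau_1<\dots<\tau_K<1$. Let $\varepsilon_1,\varepsilon_2,\dots$ be i.i.d. real random variables with distribution function $F$ and a density $f$ with $f(t)>0$ for all $t\in\mathbb R$, and let $b^*_\tau$ be the $\tau$-quantile of $F$. For each $n$ let $\mathbf X=\mathbf X_n$ be a deterministic $n\times p$ design matrix (it may vary freely with $n$; for instance its columns may be centered) with entries $x_{ij}$ and rows $\mathbf x_i^T$, and let $y_i=\mathbf x_i^T\beta^*+\varepsilon_i$, $1\le i\le n$, where $\beta^*\in\mathbb R^p$ does not depend on $n$. Put $\mathcal A=\{j:\beta_j^*\ne 0\}$. Assume: 1. $\frac1n\mathbf X^T\mathbf X\to\mathbf C$ as $n\to\infty$, where $\mathbf C$ is a positive definite $p\times p$ matrix. 2. For every $a\in\{b^*_{\tau_1},\dots,b^*_{\tau_K}\}$, every $u_0\in\mathbb R$ and every $\mathbf u\in\mathbb R^p$, $$\lim_{n\to\infty}\frac1n\sum_{i=1}^n\int_0^{u_0+\mathbf x_i^T\mathbf u}\sqrt n\,\bigl[F(a+t/\sqrt n)-F(a)\bigr]\,dt=\tfrac12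 f(a)\bigl(u_0^2+\mathbf u^T\mathbf C\mathbf u\bigr).$$ Let $\rho_\tau(t)=\tau\max(t,0)+(1-\tau)\max(-t,0)$. For all large $n$, let $\hat\beta^{\mathrm{CQR}}$ be, almost surely, the $\beta$-part of a minimizer over $b\in\mathbb R^K$, $\beta\in\mathbb R^p$ of $$\sum_{k=1}^K\sum_{i=1}^n\rho_{\tau_k}(y_i-b_k-\mathbf x_i^T\beta),$$ and let $\hat\beta^{\mathrm{ACQR}}$ be, almost surely, the $\beta$-part of a minimizer over $b\in\mathbb R^K$, $\beta\in\mathbb R^p$ of $$\sum_{k=1}^K\sum_{i=1}^n\rho_{\tau_k}(y_i-b_k-\mathbf x_i^T\beta)+\lambda_n\sum_{j=1}^p\frac{|\beta_j|}{|\hat\beta_j^{\mathrm{CQR}}|^2},$$ where a summand with $\hat\beta_j^{\mathrm{CQR}}=0$ is $+\infty$ if $\beta_j\neq0$ and $0$ if $\beta_j=0$. When minimizers are not unique, any measurable choice is allowed. If the real numbers $\lambda_n$ satisfy $\lambda_n\to\infty$ and $\lambda_n/\sqrt n\to0$, then 1. (Consistency in selection) $\Pr\bigl(\{j:\hat\beta_j^{\mathrm{ACQR}}\ne0\}=\mathcal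 A\bigr)\to1$; 2. (Asymptotic normality) $\sqrt n\,(\hat\beta^{\mathrm{ACQR}}_{\mathcal A}-\beta^*_{\mathcal A})\to_d N(0,\Sigma_{\mathrm{CQRoracle}})$, where $$\Sigma_{\mathrm{CQRoracle}}=\mathbf C_{\mathcal A\mathcal A}^{-1}\,\frac{\sum_{k,k'=1}^K\min(\tau_k,\tau_{k'})\,(1-\max(\tau_k,\tau_{k'}))}{\bigl(\sum_{k=1}^K f(b^*_{\tau_k})\bigr)^2}$$ and $\mathbf C_{\mathcal A\mathcal A}$ is the submatrix of $\mathbf C$ with row and column indices in $\mathcal A$. -/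

import Mathlib

open MeasureTheory ProbabilityTheory Filter Topology
open scoped Matrix

noncomputable section

/-- The check function `ρ_τ(t) = τ t₊ + (1 - τ) t₋`. -/
def checkFun (τ t : ℝ) : ℝ := τ * max t 0 + (1 - τ) * max (-t) 0

/-- The composite quantile regression criterion
`∑ₖ ∑ᵢ ρ_{τₖ}(yᵢ - bₖ - xᵢᵀ β)` for the design `X` (with rows `xᵢ`) and responses `y`. -/
def cqrLoss {n p K : ℕ} (τ : Fin K → ℝ) (X : Matrix (Fin n) (Fin p) ℝ) (y : Fin n → ℝ)
    (b : Fin K → ℝ) (β : Fin p → ℝ) : ℝ :=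
  ∑ k, ∑ i, checkFun (τ k) (y i - b k - ∑ j, X i j * β j)

/-- `β` is a composite quantile regression estimate: for some intercepts `b`, the pair `(b, β)`
minimizes the criterion over all intercepts and all coefficient vectors. -/
def IsCQREstimate {n p K : ℕ} (τ : Fin K → ℝ) (X : Matrix (Fin n) (Fin p) ℝ) (y : Fin n → ℝ)
    (β : Fin p → ℝ) : Prop :=
  ∃ b : Fin K → ℝ, ∀ (b' : Fin K → ℝ) (β' : Fin p → ℝ),
    cqrLoss τ X y b β ≤ cqrLoss τ X y b' β'

/-- The adaptive lasso penalized criterion, with weights `1 / |β̂ⱼ|²` built from a pilot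
estimate `β̂`. -/
def acqrLoss {n p K : ℕ} (τ : Fin K → ℝ) (X : Matrix (Fin n) (Fin p) ℝ) (y : Fin n → ℝ)
    (lam : ℝ) (pilot : Fin p → ℝ) (b : Fin K → ℝ) (β : Fin p → ℝ) : ℝ :=
  cqrLoss τ X y b β + lam * ∑ j, |β j| / |pilot j| ^ 2

/-- The weight of the coordinate `j` is infinite when `β̂ⱼ = 0`; the penalty is then `+∞` unless
`βⱼ = 0`, when it is `0`. So the penalized criterion is finite exactly on this set, and there it
is equal to `acqrLoss` (where `0 / 0 = 0`). -/
def PenaltyFinite {p : ℕ} (pilot β : Fin p → ℝ) : Prop := ∀ j, pilot j = 0 → β j = 0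

/-- `β` is an adaptive lasso penalized composite quantile regression estimate with pilot
estimate `pilot` : for some intercepts `b`, the pair `(b, β)` minimizes the penalized criterion
over all intercepts and all coefficient vectors (those with an infinite penalty being
irrelevant). -/
def IsACQREstimate {n p K : ℕ} (τ : Fin K → ℝ) (X : Matrix (Fin n) (Fin p) ℝ) (y : Fin n → ℝ)
    (lam : ℝ) (pilot β : Fin p → ℝ) : Prop :=
  PenaltyFinite pilot β ∧ ∃ b : Fin K → ℝ, ∀ (b' : Fin K → ℝ) (β' : Fin p → ℝ),
    PenaltyFinite pilot β' → acqrLoss τ X y lam pilot b β ≤ acqrLoss τ X y lam pilot b' β'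

/-- The responses `yᵢ = xᵢᵀ β + εᵢ`, `i = 1, …, n`, of the linear model. -/
def linearResponse {n p : ℕ} (X : Matrix (Fin n) (Fin p) ℝ) (β : Fin p → ℝ) (ε : ℕ → ℝ) :
    Fin n → ℝ :=
  fun i => ∑ j, X i j * β j + ε i

/-- The measure on `ℝ` with density `f`. -/
def densityLaw (f : ℝ → ℝ) : Measure ℝ := volume.withDensity fun t => ENNReal.ofReal (f t)

/-- The `τ`-quantile `F⁻¹(τ) = inf {t : F t ≥ τ}` of a law on `ℝ`. -/
def quantile (μ : Measure ℝ) (τ : ℝ) : ℝ := sInf {t : ℝ | τ ≤ cdf μ t}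

/-- The set of indices of nonzero coefficients. -/
def coefSupport {p : ℕ} (β : Fin p → ℝ) : Finset (Fin p) := {j | β j ≠ 0}

/-- The scalar factor
`(∑_{k,k'} min(τₖ, τₖ') (1 - max(τₖ, τₖ'))) / (∑ₖ f(b*_{τₖ}))²` of the asymptotic covariance. -/
def cqrVarianceFactor {K : ℕ} (τ : Fin K → ℝ) (f : ℝ → ℝ) : ℝ :=
  (∑ k, ∑ k', min (τ k) (τ k') * (1 - max (τ k) (τ k'))) /
    (∑ k, f (quantile (densityLaw f) (τ k))) ^ 2

/-- The asymptotic covariance of the oracle: the scalar factor times the inverse of the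
submatrix of `C` with row and column indices in `A`. -/
def cqrOracleCov {p K : ℕ} (τ : Fin K → ℝ) (f : ℝ → ℝ) (C : Matrix (Fin p) (Fin p) ℝ)
    (A : Finset (Fin p)) : Matrix A A ℝ :=
  cqrVarianceFactor τ f • (C.submatrix (fun j : A => (j : Fin p)) (fun j : A => (j : Fin p)))⁻¹

end

/-! In the local variables `u₀ = √n (b - b*)` and `u = √n (β - β*)`, Knight's identity splits the
increment of the criterion into a linear form in normalized scores and a nonnegative remainder. The
mean of the remainder converges to the quadratic form of the second assumption, and its variance is
at most that mean times the largest shift of a residual. So the remainder converges in probability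
as soon as no single row of the design dominates. This negligibility is not a hypothesis:
`eventually_forall_abs_le_of_tendsto_sum` extracts it from the second assumption, because the mean
remainder of one row grows at most linearly while the limit scales quadratically.

The criterion is thus convex and pointwise close to a fixed positive definite quadratic plus a
linear form with tight coefficients. `tendsto_argmin_of_convexOn` and `tendsto_restricted_argmin`
show that its minimizers follow those of the quadratic. The limit has no cross term between
intercepts and slopes, so the slopes are asymptotically a fixed matrix applied to `coefScore` alone.

For the pilot this gives root-`n` boundedness. Outside the support the penalty weight is then at
least of order `n λ_n`, which beats the Lipschitz constant of the criterion, of order `n`, and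
forces the coordinate to zero (`IsACQREstimate.weight_le`). On the support the penalty increment is
of order `λ_n / √n` and disappears. What remains is a linear statistic, whose limit law comes from
characteristic functions; Slutsky's lemma transfers it to the estimate.

Convergence in probability is convergence along the filter `whp`. Once the scores are bounded, the
argument is deterministic along a filter `l ≤ whp P`, where ultrafilters and compactness replace
subsequences. -/

noncomputable section

/-! ### Convergence in probability as convergence along a filter -/

/-- The filter of the sets `s` of pairs `(n, ω)` whose sections have probability tending to `1`. -/
def whp {Ω : Type*} [MeasurableSpace Ω] (P : Measure Ω) : Filter (ℕ × Ω) where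
  sets := {s | Tendsto (fun n => P {ω | (n, ω) ∉ s}) atTop (𝓝 0)}
  univ_sets := by simp
  sets_of_superset := by
    intro s t hs hst
    exact tendsto_of_tendsto_of_tendsto_of_le_of_le tendsto_const_nhds hs (fun _ => zero_le)
      fun n => measure_mono fun ω h h' => h (hst h')
  inter_sets := by
    intro s t hs ht
    have h := Tendsto.add hs ht
    rw [add_zero] at h
    refine tendsto_of_tendsto_of_tendsto_of_le_of_le tendsto_const_nhds h (fun _ => zero_le)
      fun n => le_trans (measure_mono ?_) (measure_union_le _ _)
    intro ω hω
    by_contra hc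
    simp only [Set.mem_union, Set.mem_ofPred_eq, not_or, not_not] at hc
    exact hω hc

section whp

variable {Ω : Type*} [MeasurableSpace Ω] {P : Measure Ω}

lemma mem_whp {s : Set (ℕ × Ω)} :
    s ∈ whp P ↔ Tendsto (fun n => P {ω | (n, ω) ∉ s}) atTop (𝓝 0) := Iff.rfl

lemma eventually_whp_of_ae {p : ℕ → Ω → Prop} (h : ∀ᶠ n in atTop, ∀ᵐ ω ∂P, p n ω) :
    ∀ᶠ q in whp P, p q.1 q.2 := by
  refine mem_whp.2 (tendsto_const_nhds.congr' ?_)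
  filter_upwards [h] with n hn
  exact (ae_iff.1 hn).symm

lemma tendsto_fst_whp : Tendsto Prod.fst (whp P) atTop := by
  intro s hs
  refine eventually_whp_of_ae (p := fun n _ => n ∈ s) ?_
  filter_upwards [hs] with n hn
  simp [hn]

lemma tendsto_measure_of_whp [IsProbabilityMeasure P] {p : ℕ → Ω → Prop}
    (h : ∀ᶠ q in whp P, p q.1 q.2) : Tendsto (fun n => P {ω | p n ω}) atTop (𝓝 1) := by
  have h0 : Tendsto (fun n => 1 - P {ω | ¬ p n ω}) atTop (𝓝 (1 - 0)) :=
    ENNReal.Tendsto.sub tendsto_const_nhds (mem_whp.1 h) (Or.inl ENNReal.one_ne_top)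
  rw [tsub_zero] at h0
  refine tendsto_of_tendsto_of_tendsto_of_le_of_le h0 tendsto_const_nhds
    (fun n => ?_) (fun n => prob_le_one)
  rw [tsub_le_iff_right, ← measure_univ (μ := P)]
  refine le_trans (measure_mono fun ω _ => ?_) (measure_union_le _ _)
  exact em (p n ω)

/-- A tight sequence exceeds a large `M` with probability at most `δ / 2`, so it may be treated as
bounded when an event is to be shown asymptotically sure. -/
lemma mem_whp_of_tight {E : Type*} [Norm E] {W : ℕ → Ω → E}
    (hW : ∀ δ : ENNReal, 0 < δ → ∃ M : ℝ, ∀ᶠ n in atTop, P {ω | M < ‖W n ω‖} ≤ δ)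
    {s : Set (ℕ × Ω)} (hs : ∀ M : ℝ, s ∈ whp P ⊓ 𝓟 {q | ‖W q.1 q.2‖ ≤ M}) : s ∈ whp P := by
  refine mem_whp.2 (ENNReal.tendsto_nhds_zero.2 fun δ hδ => ?_)
  have hδ2 : 0 < δ / 2 := ENNReal.half_pos hδ.ne'
  obtain ⟨M, hM⟩ := hW _ hδ2
  have h := ENNReal.tendsto_nhds_zero.1 (mem_whp.1 (mem_inf_principal.1 (hs M))) _ hδ2
  filter_upwards [h, hM] with n h1 h2
  calc P {ω | (n, ω) ∉ s} ≤ P ({ω | (n, ω) ∉ {x | x ∈ {q : ℕ × Ω | ‖W q.1 q.2‖ ≤ M} → x ∈ s}} ∪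
        {ω | M < ‖W n ω‖}) := by
        refine measure_mono fun ω hω => ?_
        simp only [Set.mem_union, Set.mem_ofPred_eq] at hω ⊢
        by_cases hc : M < ‖W n ω‖
        · exact Or.inr hc
        · exact Or.inl fun h' => hω (h' (not_lt.1 hc))
    _ ≤ δ / 2 + δ / 2 := (measure_union_le _ _).trans (add_le_add h1 h2)
    _ = δ := ENNReal.add_halves δ

end whp

/-! ### Stability of minimizers under pointwise convex convergence -/

/-- Minimizers of convex functions that converge pointwise to a continuous function with a strict
minimum converge to that minimum. -/
theorem tendsto_argmin_of_convexOn {E : Type*} [NormedAddCommGroup E] [NormedSpace ℝ E]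
    [FiniteDimensional ℝ E] {α : Type*} {l : Filter α} {H : α → E → ℝ} {h : E → ℝ} {m : E}
    {x : α → E} (hconv : ∀ᶠ a in l, ConvexOn ℝ Set.univ (H a))
    (hlim : ∀ y, Tendsto (fun a => H a y) l (𝓝 (h y))) (hc : Continuous h)
    (hm : ∀ y, y ≠ m → h m < h y) (hx : ∀ᶠ a in l, ∀ y, H a (x a) ≤ H a y) :
    Tendsto x l (𝓝 m) := by
  -- Along an ultrafilter, failure of convergence means that `x` stays at distance at least `δ` from
  -- `m` eventually, and points of a compact set converge.
  rw [tendsto_iff_ultrafilter]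
  intro g hg
  rw [Metric.tendsto_nhds]
  intro δ hδ
  by_contra hcon
  rw [← Ultrafilter.eventually_not] at hcon
  have hconv' := hconv.filter_mono hg
  have hx' := hx.filter_mono hg
  have hlim' : ∀ y, Tendsto (fun a => H a y) g (𝓝 (h y)) := fun y => (hlim y).mono_left hg
  -- Pulling the minimizer back radially to the sphere of radius `δ` keeps the value below `H a m`,
  -- by convexity.
  let z : α → E := fun a => m + (δ / ‖x a - m‖) • (x a - m)
  have hz : ∀ᶠ a in (g : Filter α), z a ∈ Metric.sphere m δ ∧ H a (z a) ≤ H a m := by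
    filter_upwards [hcon, hconv', hx'] with a h1 h2 h3
    rw [not_lt, dist_eq_norm] at h1
    have hpos : 0 < ‖x a - m‖ := hδ.trans_le h1
    refine ⟨?_, ?_⟩
    · simp only [z, mem_sphere_iff_norm, add_sub_cancel_left, norm_smul, norm_div, norm_norm,
        Real.norm_of_nonneg hδ.le]
      field_simp
    · have ht0 : 0 ≤ δ / ‖x a - m‖ := by positivity
      have ht1 : δ / ‖x a - m‖ ≤ 1 := (div_le_one hpos).2 h1
      have := h2.2 (Set.mem_univ m) (Set.mem_univ (x a)) (sub_nonneg.2 ht1) ht0 (by ring)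
      have e : (1 - δ / ‖x a - m‖) • m + (δ / ‖x a - m‖) • x a = z a := by
        simp only [z, smul_sub, sub_smul, one_smul]; abel
      rw [e] at this
      refine this.trans ?_
      have h4 := mul_le_mul_of_nonneg_left (h3 m) ht0
      simp only [smul_eq_mul]
      linarith
  obtain ⟨s, hs, hzs⟩ := (isCompact_sphere m δ).ultrafilter_le_nhds (g.map z)
    (le_principal_iff.2 (hz.mono fun a ha => ha.1))
  have hzs : Tendsto z g (𝓝 s) := hzs
  have hsm : s ≠ m := by
    rintro rfl
    simp at hs
    exact hδ.ne hs
  set η := (h s - h m) / 6 with hη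
  have hη0 : 0 < η := by have := hm s hsm; simp only [hη]; linarith
  -- Convergence is only pointwise while `z` moves. A simplex around `s` repairs this: convexity
  -- bounds `H a` on the whole simplex by its values at finitely many vertices.
  obtain ⟨b, hb1, hb2⟩ := exists_mem_interior_convexHull_affineBasis
    (hc.continuousAt.eventually (gt_mem_nhds (show h s < h s + η by linarith)) :
      ∀ᶠ y in 𝓝 s, h y < h s + η)
  -- The reflection of `z a` through `s` also ends in the simplex, so `s` is the midpoint of a point
  -- with low value and a point of controlled value.
  have hrefl : Tendsto (fun a => (2 : ℝ) • s - z a) g (𝓝 s) := by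
    have : Tendsto (fun a => (2 : ℝ) • s - z a) g (𝓝 ((2 : ℝ) • s - s)) :=
      tendsto_const_nhds.sub hzs
    rwa [show (2 : ℝ) • s - s = s by rw [two_smul, add_sub_cancel_right]] at this
  have hvert : ∀ᶠ a in (g : Filter α), ∀ i, H a (b i) < h s + 2 * η := by
    rw [eventually_all]
    intro i
    have hi : h (b i) < h s + η := hb2 (subset_convexHull ℝ _ (Set.mem_range_self i))
    exact (hlim' (b i)).eventually (gt_mem_nhds (by linarith))
  have hlow : ∀ᶠ a in (g : Filter α), h s - η < H a s :=
    (hlim' s).eventually (lt_mem_nhds (by linarith))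
  have hup : ∀ᶠ a in (g : Filter α), H a m < h m + η :=
    (hlim' m).eventually (gt_mem_nhds (by linarith))
  have hfin : ∀ᶠ a in (g : Filter α), False := by
    filter_upwards [hz, hvert, hlow, hup, hconv', hrefl.eventually (mem_interior_iff_mem_nhds.1 hb1)]
      with a h1 h2 h3 h4 h5 h6
    obtain ⟨_, ⟨i, rfl⟩, hi⟩ := (h5.subset (Set.subset_univ _)
      (convex_convexHull ℝ (Set.range b))).exists_ge_of_mem_convexHull (subset_convexHull ℝ _) h6
    have h7 := h5.2 (Set.mem_univ (z a)) (Set.mem_univ ((2 : ℝ) • s - z a))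
      (show (0 : ℝ) ≤ 1 / 2 by norm_num) (show (0 : ℝ) ≤ 1 / 2 by norm_num) (by norm_num)
    have e : (1 / 2 : ℝ) • z a + (1 / 2 : ℝ) • ((2 : ℝ) • s - z a) = s := by
      rw [smul_sub, smul_smul]; norm_num
    rw [e] at h7
    simp only [smul_eq_mul] at h7
    have := h2 i
    have := h1.2
    have : h s - h m = 6 * η := by simp only [hη]; ring
    linarith
  exact hfin.exists.elim fun _ h => h

/-! ### Negligibility of single terms from quadratic scaling -/

lemma sum_geometric_half_le (N : ℕ) : ∑ k ∈ Finset.range N, (1 / 2 : ℝ) ^ k ≤ 2 := by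
  have := sum_le_hasSum (Finset.range N) (fun i _ => by positivity) hasSum_geometric_two
  simpa using this

/-- A dyadic tail of a geometric series is at most twice its first term. -/
lemma sum_half_pow_filter_le (N : ℕ) {r : ℝ} (hr : 0 ≤ r) :
    ∑ k ∈ Finset.range N with (1 / 2 : ℝ) ^ k < r, (1 / 2 : ℝ) ^ k ≤ 2 * r := by
  rcases hr.eq_or_lt with rfl | hr
  · rw [Finset.filter_false_of_mem fun k _ => not_lt.2 (by positivity)]
    simp
  have hex := exists_pow_lt_of_lt_one hr (show (1 / 2 : ℝ) < 1 by norm_num)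
  classical
  set k₀ := Nat.find hex with hk₀
  have hk := Nat.find_spec hex
  have hsub : (Finset.range N).filter (fun k => (1 / 2 : ℝ) ^ k < r) ⊆
      (Finset.range N).image (fun k => k₀ + k) := by
    intro k hkm
    simp only [Finset.mem_filter, Finset.mem_range, Finset.mem_image] at hkm ⊢
    have := Nat.find_min' hex hkm.2
    exact ⟨k - k₀, by omega, by omega⟩
  calc _ ≤ ∑ k ∈ (Finset.range N).image (fun k => k₀ + k), (1 / 2 : ℝ) ^ k :=
        Finset.sum_le_sum_of_subset_of_nonneg hsub fun _ _ _ => by positivity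
    _ = (1 / 2 : ℝ) ^ k₀ * ∑ k ∈ Finset.range N, (1 / 2 : ℝ) ^ k := by
        rw [Finset.sum_image fun a _ b _ h => by simpa using h, Finset.mul_sum]
        simp only [pow_add]
    _ ≤ (1 / 2 : ℝ) ^ k₀ * 2 := by
        gcongr
        exact sum_geometric_half_le N
    _ ≤ 2 * r := by linarith

/-- If `∑ᵢ G (t zᵢ)` scales like `t² ∑ᵢ zᵢ²` in the limit while `G` grows at most linearly, then
no single `zᵢ` can contribute in the limit. -/
theorem eventually_forall_abs_le_of_tendsto_sum {G : ℝ → ℝ} {c v : ℝ} (hc : 0 < c)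
    (hG : ∀ s, G s ≤ |s|) (hG0 : ∀ ε > 0, ∃ η > 0, ∀ s, |s| ≤ η → G s ≤ (c + ε) * s ^ 2)
    {z : (n : ℕ) → Fin n → ℝ} (hz : Tendsto (fun n => ∑ i, z n i ^ 2) atTop (𝓝 v))
    (hGz : ∀ t : ℝ, Tendsto (fun n => ∑ i, G (t * z n i)) atTop (𝓝 (c * t ^ 2 * v)))
    {δ : ℝ} (hδ : 0 < δ) : ∀ᶠ n in atTop, ∀ i, |z n i| ≤ δ := by
  have hv : 0 ≤ v := ge_of_tendsto' hz fun n => Finset.sum_nonneg fun i _ => sq_nonneg _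
  -- With this choice the excess `N ε v` is at most a quarter of `N c δ²`; the `+ 1` covers `v = 0`.
  set ε := c * δ ^ 2 / (4 * (v + 1)) with hε
  have hε0 : 0 < ε := by positivity
  obtain ⟨η, hη, hGη⟩ := hG0 ε hε0
  obtain ⟨N, hN⟩ := exists_nat_gt (4 / (δ * c) + 2 * (v + 1) / η * 8 / (c * δ ^ 2) + 64 / δ ^ 2 / c)
  have hN0 : (0 : ℝ) < N := lt_of_le_of_lt (by positivity) hN
  have hN1 : 2 / δ ≤ N * c / 2 := by
    have : 4 / (δ * c) ≤ N := by
      refine le_trans ?_ hN.le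
      have : 0 ≤ 2 * (v + 1) / η * 8 / (c * δ ^ 2) := by positivity
      have : 0 ≤ 64 / δ ^ 2 / c := by positivity
      linarith
    rw [div_le_iff₀ (by positivity)] at this ⊢
    linarith
  have hN2 : 2 * (v + 1) / η ≤ N * (c * δ ^ 2) / 8 := by
    have : 2 * (v + 1) / η * 8 / (c * δ ^ 2) ≤ N := by
      refine le_trans ?_ hN.le
      have : 0 ≤ 4 / (δ * c) := by positivity
      have : 0 ≤ 64 / δ ^ 2 / c := by positivity
      linarith
    rw [div_le_iff₀ (by positivity)] at this
    linarith
  have hN3 : 8 ≤ N * (c * δ ^ 2) / 8 := by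
    have : 64 / δ ^ 2 / c ≤ N := by
      refine le_trans ?_ hN.le
      have : 0 ≤ 4 / (δ * c) := by positivity
      have : 0 ≤ 2 * (v + 1) / η * 8 / (c * δ ^ 2) := by positivity
      linarith
    rw [div_div, div_le_iff₀ (by positivity)] at this
    linarith
  -- Averaging over `N` dyadic scales: a small argument can contribute about `N c x²`, but a large
  -- one at most `2 |x|`, independently of `N`. A term above `δ` would thus create a deficit of
  -- order `N c δ²`.
  let A : ℝ → ℝ := fun x => ∑ k ∈ Finset.range N, (1 / 4 : ℝ) ^ k * G (2 ^ k * x)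
  have hA1 : ∀ x, A x ≤ N * (c + ε) * x ^ 2 + 2 / η * x ^ 2 := by
    intro x
    -- The quadratic bound serves while `2 ^ k |x| ≤ η`; beyond that the linear bound leaves a
    -- geometric tail.
    have h1 : ∀ k ∈ Finset.range N, (1 / 4 : ℝ) ^ k * G (2 ^ k * x) ≤
        (c + ε) * x ^ 2 + if (1 / 2 : ℝ) ^ k < |x| / η then |x| * (1 / 2 : ℝ) ^ k else 0 := by
      intro k _
      have e2 : (1 / 2 : ℝ) ^ k * 2 ^ k = 1 := by rw [← mul_pow]; norm_num
      have e4 : (1 / 4 : ℝ) ^ k = (1 / 2 : ℝ) ^ k * (1 / 2 : ℝ) ^ k := by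
        rw [← mul_pow]; norm_num
      have hp : (0 : ℝ) < 2 ^ k := by positivity
      have hp' : (0 : ℝ) < (1 / 2) ^ k := by positivity
      split_ifs with hk
      · have h2 := mul_le_mul_of_nonneg_left (hG (2 ^ k * x)) (show (0 : ℝ) ≤ (1 / 4) ^ k by positivity)
        rw [abs_mul, abs_of_pos hp, e4] at h2
        have h3 : (1 / 2 : ℝ) ^ k * (1 / 2) ^ k * (2 ^ k * |x|) = |x| * (1 / 2) ^ k := by
          linear_combination (1 / 2 : ℝ) ^ k * |x| * e2
        have : 0 ≤ (c + ε) * x ^ 2 := by positivity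
        rw [e4]
        linarith
      · rw [not_lt, div_le_iff₀ hη] at hk
        have h2 : |2 ^ k * x| ≤ η := by
          rw [abs_mul, abs_of_pos hp]
          have := mul_le_mul_of_nonneg_left hk hp.le
          nlinarith
        have h3 := mul_le_mul_of_nonneg_left (hGη _ h2) (show (0 : ℝ) ≤ (1 / 4) ^ k by positivity)
        have h4 : (1 / 4 : ℝ) ^ k * ((c + ε) * (2 ^ k * x) ^ 2) = (c + ε) * x ^ 2 := by
          rw [e4]
          linear_combination ((1 / 2 : ℝ) ^ k * 2 ^ k + 1) * (c + ε) * x ^ 2 * e2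
        linarith
    refine (Finset.sum_le_sum h1).trans ?_
    rw [Finset.sum_add_distrib, ← Finset.sum_filter, Finset.sum_const, Finset.card_range,
      nsmul_eq_mul, ← Finset.mul_sum]
    have h5 := mul_le_mul_of_nonneg_left (sum_half_pow_filter_le N (r := |x| / η) (by positivity))
      (abs_nonneg x)
    have h6 : |x| * (2 * (|x| / η)) = 2 / η * x ^ 2 := by
      rw [← sq_abs]; ring
    linarith
  have hA2 : ∀ x, A x ≤ 2 * |x| := by
    intro x
    have h1 : ∀ k ∈ Finset.range N, (1 / 4 : ℝ) ^ k * G (2 ^ k * x) ≤ |x| * (1 / 2 : ℝ) ^ k := by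
      intro k _
      have e2 : (1 / 2 : ℝ) ^ k * 2 ^ k = 1 := by rw [← mul_pow]; norm_num
      have e4 : (1 / 4 : ℝ) ^ k = (1 / 2 : ℝ) ^ k * (1 / 2 : ℝ) ^ k := by
        rw [← mul_pow]; norm_num
      have hp : (0 : ℝ) < 2 ^ k := by positivity
      have h2 := mul_le_mul_of_nonneg_left (hG (2 ^ k * x)) (show (0 : ℝ) ≤ (1 / 4) ^ k by positivity)
      rw [abs_mul, abs_of_pos hp, e4] at h2
      have h3 : (1 / 2 : ℝ) ^ k * (1 / 2) ^ k * (2 ^ k * |x|) = |x| * (1 / 2) ^ k := by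
        linear_combination (1 / 2 : ℝ) ^ k * |x| * e2
      rw [e4]
      linarith
    refine (Finset.sum_le_sum h1).trans ?_
    rw [← Finset.mul_sum]
    have := mul_le_mul_of_nonneg_left (sum_geometric_half_le N) (abs_nonneg x)
    linarith
  -- Every scale contributes the same limit `c v`, since `4⁻ᵏ` cancels the quadratic scaling.
  have hAlim : Tendsto (fun n => ∑ i, A (z n i)) atTop (𝓝 (N * (c * v))) := by
    have h1 : Tendsto (fun n => ∑ k ∈ Finset.range N, (1 / 4 : ℝ) ^ k * ∑ i, G (2 ^ k * z n i)) atTop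
        (𝓝 (∑ k ∈ Finset.range N, (1 / 4 : ℝ) ^ k * (c * (2 ^ k) ^ 2 * v))) :=
      tendsto_finsetSum _ fun k _ => (hGz (2 ^ k)).const_mul _
    have h2 : ∑ k ∈ Finset.range N, (1 / 4 : ℝ) ^ k * (c * (2 ^ k) ^ 2 * v) = N * (c * v) := by
      have : ∀ k ∈ Finset.range N, (1 / 4 : ℝ) ^ k * (c * (2 ^ k) ^ 2 * v) = c * v := by
        intro k _
        have e2 : (1 / 4 : ℝ) ^ k * (2 ^ k) ^ 2 = 1 := by
          rw [← pow_mul, mul_comm k 2, pow_mul, ← mul_pow]; norm_num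
        linear_combination c * v * e2
      rw [Finset.sum_congr rfl this]
      simp
    rw [h2] at h1
    refine h1.congr fun n => ?_
    simp only [A, Finset.mul_sum]
    exact Finset.sum_comm
  filter_upwards [hAlim.eventually (lt_mem_nhds (show N * (c * v) - 1 < N * (c * v) by linarith)),
    hz.eventually (gt_mem_nhds (show v < v + 1 / (N * (c + ε)) by
      have : 0 < 1 / (N * (c + ε)) := by positivity
      linarith)), hz.eventually (gt_mem_nhds (show v < v + 1 by linarith))] with n h1 h2 h3 i
  by_contra hcon
  rw [not_le] at hcon
  set x := z n i with hx
  have hx2 : δ ^ 2 ≤ x ^ 2 := by rw [← sq_abs x]; gcongr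
  have hAx : A x ≤ 2 / δ * x ^ 2 := by
    refine (hA2 x).trans ?_
    rw [div_mul_eq_mul_div, le_div_iff₀ hδ, ← sq_abs x]
    nlinarith [abs_nonneg x]
  -- The offending term gets the linear bound, all others the quadratic one.
  have hsplit : ∑ i, A (z n i) ≤ (N * (c + ε) + 2 / η) * (∑ i, z n i ^ 2 - x ^ 2) + 2 / δ * x ^ 2 := by
    rw [← Finset.add_sum_erase _ _ (Finset.mem_univ i),
      ← Finset.add_sum_erase _ (fun i => z n i ^ 2) (Finset.mem_univ i), add_sub_cancel_left,
      Finset.mul_sum, add_comm]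
    refine add_le_add (Finset.sum_le_sum fun j _ => ?_) hAx
    have := hA1 (z n j)
    linarith
  have hP : N * (c + ε) * (∑ i, z n i ^ 2) ≤ N * (c + ε) * v + 1 := by
    have h4 : ∑ i, z n i ^ 2 - v ≤ 1 / (N * (c + ε)) := by linarith
    rw [le_div_iff₀ (by positivity)] at h4
    linarith
  have hQ : 2 / η * (∑ i, z n i ^ 2) ≤ N * (c * δ ^ 2) / 8 := by
    refine le_trans ?_ hN2
    rw [mul_div_right_comm]
    gcongr
  have hεv : ε * v ≤ c * δ ^ 2 / 4 := by
    rw [hε, div_mul_eq_mul_div, div_le_div_iff₀ (by positivity) (by norm_num)]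
    have : 0 ≤ c * δ ^ 2 := by positivity
    nlinarith
  have hR : 2 / δ * x ^ 2 ≤ N * c / 2 * x ^ 2 := by gcongr
  have hS : N * c / 2 * δ ^ 2 ≤ N * c / 2 * x ^ 2 := by gcongr
  have hT : 0 ≤ N * ε * x ^ 2 := by positivity
  have hU : 0 ≤ 2 / η * x ^ 2 := by positivity
  have hV := mul_le_mul_of_nonneg_left hεv hN0.le
  nlinarith


/-! ### Knight's identity -/

/-- The value `1_{r ≤ 0}`. -/
def leInd (r : ℝ) : ℝ := if r ≤ 0 then 1 else 0

/-- The nonlinear term `∫₀ˢ (1_{r ≤ t} - 1_{r ≤ 0}) dt` of Knight's identity. -/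
def knight (s r : ℝ) : ℝ := max (s - r) 0 - max (-r) 0 - s * leInd r

lemma leInd_nonneg (r : ℝ) : 0 ≤ leInd r := by unfold leInd; split_ifs <;> norm_num

lemma leInd_le_one (r : ℝ) : leInd r ≤ 1 := by unfold leInd; split_ifs <;> norm_num

@[fun_prop]
lemma measurable_leInd : Measurable leInd :=
  Measurable.ite measurableSet_Iic measurable_const measurable_const

@[fun_prop]
lemma measurable_knight (s : ℝ) : Measurable (knight s) := by
  unfold knight
  fun_prop

lemma checkFun_eq (τ t : ℝ) : checkFun τ t = τ * t + max (-t) 0 := by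
  have h := max_zero_sub_max_neg_zero_eq_self t
  unfold checkFun
  linear_combination τ * h

/-- Knight's identity. -/
lemma checkFun_sub_sub (τ r s : ℝ) :
    checkFun τ (r - s) - checkFun τ r = s * (leInd r - τ) + knight s r := by
  rw [checkFun_eq, checkFun_eq, knight, neg_sub]
  ring

lemma knight_nonneg (s r : ℝ) : 0 ≤ knight s r := by
  unfold knight leInd
  rcases max_cases (s - r) 0 with ⟨h1, h1'⟩ | ⟨h1, h1'⟩ <;>
  rcases max_cases (-r) 0 with ⟨h4, h4'⟩ | ⟨h4, h4'⟩ <;>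
  rw [h1, h4] <;> split_ifs <;> linarith

lemma knight_le_abs (s r : ℝ) : knight s r ≤ |s| := by
  unfold knight leInd
  rcases max_cases (s - r) 0 with ⟨h1, h1'⟩ | ⟨h1, h1'⟩ <;>
  rcases max_cases (-r) 0 with ⟨h4, h4'⟩ | ⟨h4, h4'⟩ <;>
  rcases abs_cases s with ⟨h5, h5'⟩ | ⟨h5, h5'⟩ <;>
  rw [h1, h4, h5] <;> split_ifs <;> linarith

lemma intervalIntegrable_leInd (a b r : ℝ) :
    IntervalIntegrable (fun t => leInd (r - t)) volume a b := by
  refine (intervalIntegrable_const (c := (1 : ℝ))).mono_fun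
    (Measurable.aestronglyMeasurable (by fun_prop)) ?_
  refine Eventually.of_forall fun t => ?_
  simp only
  rw [Real.norm_of_nonneg (leInd_nonneg _), norm_one]
  exact leInd_le_one _

lemma knight_eq_integral (s r : ℝ) :
    knight s r = ∫ t in (0 : ℝ)..s, (leInd (r - t) - leInd r) := by
  have h : ∫ t in (0 : ℝ)..s, leInd (r - t) = max (s - r) 0 - max (0 - r) 0 := by
    -- The primitive `max (t - r) 0` has a kink only at `t = r`.
    refine integral_eq_of_hasDerivAt_off_countable (fun t => max (t - r) 0) _
      (Set.countable_singleton r) (by fun_prop) ?_ (intervalIntegrable_leInd _ _ _)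
    rintro t ⟨-, ht⟩
    rcases lt_or_gt_of_ne (show t ≠ r from ht) with h | h
    · have h1 : leInd (r - t) = 0 := if_neg (by linarith)
      rw [h1]
      refine (hasDerivAt_const t (0 : ℝ)).congr_of_eventuallyEq ?_
      filter_upwards [gt_mem_nhds h] with x hx
      exact max_eq_right (by linarith)
    · have h1 : leInd (r - t) = 1 := if_pos (by linarith)
      rw [h1]
      refine ((hasDerivAt_id t).sub_const r).congr_of_eventuallyEq ?_
      filter_upwards [lt_mem_nhds h] with x hx
      exact max_eq_left (by linarith)
  rw [intervalIntegral.integral_sub (intervalIntegrable_leInd _ _ _) (by simp), h]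
  simp [knight]

/-! ### Means and variances under the error law -/

section law

variable {μ : Measure ℝ}

lemma integral_leInd_sub [IsProbabilityMeasure μ] (b : ℝ) : ∫ x, leInd (x - b) ∂μ = cdf μ b := by
  rw [cdf_eq_real, ← integral_indicator_one measurableSet_Iic]
  congr 1 with x
  simp [leInd, Set.indicator_apply]

/-- Fubini turns the mean of the remainder into the integral of increments of the distribution
function, the quantity controlled by the second assumption. -/
lemma integral_knight [IsProbabilityMeasure μ] (s b : ℝ) :
    ∫ x, knight s (x - b) ∂μ = ∫ t in (0 : ℝ)..s, (cdf μ (b + t) - cdf μ b) := by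
  simp_rw [knight_eq_integral]
  have hint : ∀ c, Integrable (fun x => leInd (x - c)) μ := by
    intro c
    refine Integrable.of_bound (Measurable.aestronglyMeasurable (by fun_prop)) 1 (Eventually.of_forall fun x => ?_)
    rw [Real.norm_of_nonneg (leInd_nonneg _)]
    exact leInd_le_one _
  rw [← intervalIntegral_integral_swap]
  · refine intervalIntegral.integral_congr fun t _ => ?_
    simp only [sub_sub]
    rw [integral_sub (hint _) (hint _), integral_leInd_sub, integral_leInd_sub]
  · have : IsFiniteMeasure (volume.restrict (Set.uIoc 0 s)) :=
      ⟨by simp [Set.uIoc]⟩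
    refine Integrable.of_bound (C := 1) (Measurable.aestronglyMeasurable ?_) (Eventually.of_forall fun q => ?_)
    · unfold Function.uncurry
      fun_prop
    simp only [Function.uncurry, Real.norm_eq_abs, abs_le]
    have h1 := leInd_nonneg (q.2 - b - q.1)
    have h2 := leInd_le_one (q.2 - b - q.1)
    have h3 := leInd_nonneg (q.2 - b)
    have h4 := leInd_le_one (q.2 - b)
    constructor <;> linarith

variable {Ω : Type*} [MeasurableSpace Ω] {P : Measure Ω} [IsProbabilityMeasure P]

/-- Chebyshev's inequality for a sum of bounded functions of independent variables. -/
lemma measure_le_abs_sum_sub_le {ε : ℕ → Ω → ℝ} (hlaw : ∀ i, HasLaw (ε i) μ P)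
    (hind : iIndepFun ε P) {n : ℕ} {g : Fin n → ℝ → ℝ} (hg : ∀ i, Measurable (g i))
    {B : Fin n → ℝ} (hB : ∀ i x, |g i x| ≤ B i) {M : ℝ} (hM : 0 < M) :
    P {ω | M ≤ |∑ i, g i (ε i ω) - ∑ i, ∫ x, g i x ∂μ|} ≤
      ENNReal.ofReal ((∑ i, ∫ x, g i x ^ 2 ∂μ) / M ^ 2) := by
  have hae : ∀ i : Fin n, AEMeasurable (fun ω => g i (ε i ω)) P := fun i =>
    (hg i).comp_aemeasurable (hlaw i).aemeasurable
  have hL : ∀ i : Fin n, MemLp (fun ω => g i (ε i ω)) 2 P := fun i =>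
    MemLp.of_bound (hae i).aestronglyMeasurable (B i) (Eventually.of_forall fun ω => hB i _)
  have hmean : ∀ i : Fin n, ∫ ω, g i (ε i ω) ∂P = ∫ x, g i x ∂μ := fun i =>
    (hlaw i).integral_comp (hg i).aestronglyMeasurable
  have hsq : ∀ i : Fin n, ∫ ω, g i (ε i ω) ^ 2 ∂P = ∫ x, g i x ^ 2 ∂μ := fun i =>
    (hlaw i).integral_comp (f := fun x => g i x ^ 2) ((hg i).pow_const 2).aestronglyMeasurable
  have hsum : MemLp (∑ i, fun ω => g i (ε i ω)) 2 P := memLp_finsetSum' _ fun i _ => hL i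
  have hvar : Var[∑ i, fun ω => g i (ε i ω); P] ≤ ∑ i, ∫ x, g i x ^ 2 ∂μ := by
    rw [IndepFun.variance_sum fun i _ => hL i]
    · refine Finset.sum_le_sum fun i _ => ?_
      refine (variance_le_expectation_sq (hae i).aestronglyMeasurable).trans_eq ?_
      exact hsq i
    · intro i _ j _ hij
      exact (hind.indepFun (Fin.val_injective.ne hij)).comp (hg i) (hg j)
  have h := meas_ge_le_variance_div_sq hsum hM
  have he : P[∑ i, fun ω => g i (ε i ω)] = ∑ i, ∫ x, g i x ∂μ := by
    simp only [Finset.sum_apply]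
    rw [integral_finsetSum _ fun i _ => (hL i).integrable one_le_two]
    exact Finset.sum_congr rfl fun i _ => hmean i
  rw [he] at h
  simp only [Finset.sum_apply] at h
  refine h.trans (ENNReal.ofReal_le_ofReal ?_)
  gcongr

end law

/-! ### Characteristic functions of weighted triangular arrays -/

lemma norm_prod_sub_prod_le {ι : Type*} (s : Finset ι) {a b : ι → ℂ} (ha : ∀ i, ‖a i‖ ≤ 1)
    (hb : ∀ i, ‖b i‖ ≤ 1) : ‖∏ i ∈ s, a i - ∏ i ∈ s, b i‖ ≤ ∑ i ∈ s, ‖a i - b i‖ := by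
  classical
  induction s using Finset.induction_on with
  | empty => simp
  | insert i s hi ih =>
    rw [Finset.prod_insert hi, Finset.prod_insert hi, Finset.sum_insert hi]
    have hp : ‖∏ j ∈ s, a j‖ ≤ 1 := by
      rw [norm_prod]
      exact Finset.prod_le_one (fun _ _ => norm_nonneg _) fun j _ => ha j
    calc ‖a i * ∏ j ∈ s, a j - b i * ∏ j ∈ s, b j‖
        = ‖(a i - b i) * ∏ j ∈ s, a j + b i * (∏ j ∈ s, a j - ∏ j ∈ s, b j)‖ := by ring_nf
      _ ≤ ‖a i - b i‖ * ‖∏ j ∈ s, a j‖ + ‖b i‖ * ‖∏ j ∈ s, a j - ∏ j ∈ s, b j‖ := by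
          rw [← norm_mul, ← norm_mul]
          exact norm_add_le _ _
      _ ≤ ‖a i - b i‖ * 1 + 1 * ∑ j ∈ s, ‖a j - b j‖ := by
          gcongr
          exact hb i
      _ = _ := by ring

open Asymptotics in
/-- Second order expansion of a characteristic function. -/
lemma charFun_sub_isLittleO {ν : Measure ℝ} [IsProbabilityMeasure ν] (h2 : MemLp id 2 ν)
    (h0 : ∫ x, x ∂ν = 0) :
    (fun t : ℝ => charFun ν t - (1 - ((∫ x, x ^ 2 ∂ν : ℝ) : ℂ) * t ^ 2 / 2)) =o[𝓝 0]
      fun t => t ^ 2 := by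
  have h1 : ∀ t : ℝ, taylorWithinEval (charFun ν) 2 Set.univ 0 t =
      1 - ((∫ x, x ^ 2 ∂ν : ℝ) : ℂ) * t ^ 2 / 2 := by
    intro t
    have := taylorWithinEval_charFun_two_zero (P := ν) (X := id) aemeasurable_id
      (by simpa using h2) t
    simpa [h0] using this
  simp_rw [← h1]
  convert! taylor_isLittleO_univ (contDiff_charFun h2)
  simp

open Asymptotics in
/-- Triangular arrays of multiples of a square integrable centered variable: the product of the
characteristic functions converges to the Gaussian one under a uniform negligibility condition. -/
theorem tendsto_prod_charFun {ν : Measure ℝ} [IsProbabilityMeasure ν] (h2 : MemLp id 2 ν)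
    (h0 : ∫ x, x ∂ν = 0) {c : (n : ℕ) → Fin n → ℝ} {v : ℝ}
    (hc : Tendsto (fun n => ∑ i, c n i ^ 2) atTop (𝓝 v))
    (hmax : ∀ δ > 0, ∀ᶠ n in atTop, ∀ i, |c n i| ≤ δ) :
    Tendsto (fun n => ∏ i, charFun ν (c n i)) atTop
      (𝓝 (Complex.exp (-((∫ x, x ^ 2 ∂ν : ℝ) * v / 2 : ℝ)))) := by
  set σ2 : ℝ := ∫ x, x ^ 2 ∂ν with hσ2
  have hσ0 : 0 ≤ σ2 := integral_nonneg fun x => sq_nonneg x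
  let e : ℝ → ℂ := fun t => Complex.exp (-(σ2 * t ^ 2 / 2 : ℝ))
  have he : (fun t : ℝ => e t - (1 - (σ2 : ℂ) * t ^ 2 / 2)) =o[𝓝 0] fun t => t ^ 2 := by
    -- The Gaussian with the same variance satisfies the same expansion, so the two characteristic
    -- functions agree up to `o(t²)` and can be exchanged factor by factor.
    have h1 := charFun_sub_isLittleO (ν := gaussianReal 0 σ2.toNNReal) (memLp_id_gaussianReal 2)
      (by simp)
    have hm : ∫ x, x ^ 2 ∂(gaussianReal 0 σ2.toNNReal) = σ2 := by
      have := variance_eq_integral (μ := gaussianReal 0 σ2.toNNReal) (X := id) aemeasurable_id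
      rw [variance_id_gaussianReal] at this
      simpa [hσ0] using this.symm
    rw [hm] at h1
    refine h1.congr_left fun t => ?_
    simp only [e, charFun_gaussianReal]
    congr 2
    simp [hσ0]
  have hd : (fun t : ℝ => charFun ν t - e t) =o[𝓝 0] fun t => t ^ 2 := by
    refine ((charFun_sub_isLittleO h2 h0).sub he).congr_left fun t => ?_
    ring
  have he1 : ∀ t, ‖e t‖ ≤ 1 := by
    intro t
    simp only [e, ← Complex.ofReal_neg, ← Complex.ofReal_exp, Complex.norm_real,
      Real.norm_of_nonneg (Real.exp_nonneg _), Real.exp_le_one_iff]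
    have : 0 ≤ σ2 * t ^ 2 / 2 := by positivity
    linarith
  have hprod : Tendsto (fun n => ∏ i, e (c n i)) atTop (𝓝 (Complex.exp (-(σ2 * v / 2 : ℝ)))) := by
    have h1 : ∀ n, ∏ i, e (c n i) = Complex.exp (-(σ2 * (∑ i, c n i ^ 2) / 2 : ℝ)) := by
      intro n
      simp only [e]
      rw [← Complex.exp_sum, Finset.mul_sum, Finset.sum_div]
      push_cast
      rw [Finset.sum_neg_distrib]
    simp_rw [h1]
    refine (Complex.continuous_exp.tendsto _).comp (Tendsto.neg ?_)
    exact (Complex.continuous_ofReal.tendsto _).comp ((hc.const_mul σ2).div_const 2)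
  have hdiff : Tendsto (fun n => ∏ i, charFun ν (c n i) - ∏ i, e (c n i)) atTop (𝓝 0) := by
    rw [Metric.tendsto_nhds]
    intro r hr
    have hv : 0 ≤ v := ge_of_tendsto' hc fun n => Finset.sum_nonneg fun i _ => sq_nonneg _
    have hb := hd.def (show 0 < r / (v + 2) by positivity)
    obtain ⟨η, hη, hη'⟩ := Metric.eventually_nhds_iff.1 hb
    filter_upwards [hmax (η / 2) (half_pos hη), hc.eventually (gt_mem_nhds (lt_add_one v))]
      with n h3 h4
    rw [dist_zero_right]
    calc _ ≤ ∑ i, ‖charFun ν (c n i) - e (c n i)‖ :=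
          norm_prod_sub_prod_le _ (fun i => norm_charFun_le_one _) fun i => he1 _
      _ ≤ ∑ i, r / (v + 2) * c n i ^ 2 := by
          refine Finset.sum_le_sum fun i _ => ?_
          have h5 := hη' (y := c n i) (by
            rw [dist_zero_right, Real.norm_eq_abs]
            linarith [h3 i])
          simpa using h5
      _ < r := by
          rw [← Finset.mul_sum, div_mul_eq_mul_div, div_lt_iff₀ (by positivity)]
          nlinarith
  simpa using hdiff.add hprod


/-! ### From Chebyshev bounds to convergence and tightness -/

lemma tendsto_whp_of_deviation {Ω : Type*} [MeasurableSpace Ω] {P : Measure Ω} {T : ℕ → Ω → ℝ}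
    {e V : ℕ → ℝ} {L : ℝ} (he : Tendsto e atTop (𝓝 L)) (hV : Tendsto V atTop (𝓝 0))
    (h : ∀ n, ∀ M > 0, P {ω | M ≤ |T n ω - e n|} ≤ ENNReal.ofReal (V n / M ^ 2)) :
    Tendsto (fun q : ℕ × Ω => T q.1 q.2) (whp P) (𝓝 L) := by
  have h1 : Tendsto (fun q : ℕ × Ω => T q.1 q.2 - e q.1) (whp P) (𝓝 0) := by
    rw [Metric.tendsto_nhds]
    intro M hM
    refine mem_whp.2 ?_
    have hV' : Tendsto (fun n => ENNReal.ofReal (V n / M ^ 2)) atTop (𝓝 0) := by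
      have := ENNReal.tendsto_ofReal (hV.div_const (M ^ 2))
      simpa using this
    refine tendsto_of_tendsto_of_tendsto_of_le_of_le tendsto_const_nhds hV' (fun _ => zero_le)
      fun n => le_trans (measure_mono fun ω hω => ?_) (h n M hM)
    simpa [Real.dist_eq] using hω
  simpa using h1.add (he.comp tendsto_fst_whp)

lemma exists_forall_measure_norm_le {Ω : Type*} [MeasurableSpace Ω] {P : Measure Ω}
    {ι : Type*} [Fintype ι] {W : ℕ → Ω → ι → ℝ} {V : ℝ}
    (h : ∀ i, ∀ᶠ n in atTop, ∀ M > 0, P {ω | M ≤ |W n ω i|} ≤ ENNReal.ofReal (V / M ^ 2))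
    (δ : ENNReal) (hδ : 0 < δ) : ∃ M : ℝ, ∀ᶠ n in atTop, P {ω | M < ‖W n ω‖} ≤ δ := by
  have h1 : Tendsto (fun M : ℝ => Fintype.card ι * ENNReal.ofReal (V / M ^ 2)) atTop (𝓝 0) := by
    have h2 : Tendsto (fun M : ℝ => V / M ^ 2) atTop (𝓝 0) :=
      tendsto_const_nhds.div_atTop (tendsto_pow_atTop two_ne_zero)
    have h3 := ENNReal.Tendsto.const_mul (a := (Fintype.card ι : ENNReal))
      (ENNReal.tendsto_ofReal h2) (Or.inr (ENNReal.natCast_ne_top _))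
    simpa using h3
  obtain ⟨M, hM1, hM0⟩ := ((h1.eventually (ge_mem_nhds hδ)).and (eventually_gt_atTop 0)).exists
  refine ⟨M, ?_⟩
  filter_upwards [eventually_all.2 h] with n hn
  calc P {ω | M < ‖W n ω‖} ≤ P (⋃ i, {ω | M ≤ |W n ω i|}) := by
        refine measure_mono fun ω hω => ?_
        by_contra hc
        simp only [Set.mem_iUnion, Set.mem_ofPred_eq, not_exists, not_le] at hc hω
        exact hω.not_ge ((pi_norm_le_iff_of_nonneg hM0.le).2 fun i => (hc i).le)
    _ ≤ ∑ i, P {ω | M ≤ |W n ω i|} := measure_iUnion_fintype_le _ _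
    _ ≤ ∑ _i : ι, ENNReal.ofReal (V / M ^ 2) := Finset.sum_le_sum fun i _ => hn i M hM0
    _ ≤ δ := by simpa using hM1

/-! ### Quantiles of a law with a density -/

section quantile

variable {f : ℝ → ℝ} [IsProbabilityMeasure (densityLaw f)]

lemma continuous_cdf_densityLaw : Continuous (cdf (densityLaw f)) := by
  have hna : ∀ x, densityLaw f {x} = 0 := fun x =>
    withDensity_absolutelyContinuous _ _ (measure_singleton x)
  rw [continuous_iff_continuousAt]
  intro x
  rw [(monotone_cdf (densityLaw f)).continuousAt_iff_leftLim_eq_rightLim,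
    (cdf (densityLaw f)).rightLim_eq]
  have h := (cdf (densityLaw f)).measure_singleton x
  rw [measure_cdf, hna, eq_comm, ENNReal.ofReal_eq_zero] at h
  exact le_antisymm ((monotone_cdf _).leftLim_le le_rfl) (by linarith)

/-- A law with a density has no atoms, so its distribution function is continuous: it attains the
level `τ` and the infimum is a minimum. -/
lemma cdf_quantile {τ : ℝ} (h0 : 0 < τ) (h1 : τ < 1) :
    cdf (densityLaw f) (quantile (densityLaw f) τ) = τ := by
  set F := cdf (densityLaw f) with hF
  have hc : Continuous F := continuous_cdf_densityLaw
  obtain ⟨a, ha⟩ := ((tendsto_cdf_atBot (densityLaw f)).eventually (gt_mem_nhds h0)).exists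
  obtain ⟨b, hb⟩ := ((tendsto_cdf_atTop (densityLaw f)).eventually (lt_mem_nhds h1)).exists
  obtain ⟨t, ht⟩ := mem_range_of_exists_le_of_exists_ge hc ⟨a, ha.le⟩ ⟨b, hb.le⟩
  have hbdd : BddBelow {t : ℝ | τ ≤ F t} := by
    refine ⟨a, fun s hs => ?_⟩
    by_contra hcon
    exact absurd ((monotone_cdf (densityLaw f)) (not_le.1 hcon).le) (not_le.2 (ha.trans_le hs))
  have hmem : quantile (densityLaw f) τ ∈ {t : ℝ | τ ≤ F t} :=
    (isClosed_le continuous_const hc).csInf_mem ⟨t, ht.ge⟩ hbdd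
  refine le_antisymm ?_ hmem
  exact (monotone_cdf (densityLaw f) (csInf_le hbdd (show τ ≤ F t from ht.ge))).trans ht.le

end quantile

/-! ### The mean remainder near zero -/

section meanKnight

variable (μ : Measure ℝ) [IsProbabilityMeasure μ] (a : ℝ)

/-- The mean of the nonlinear term of Knight's identity. -/
def meanKnight (μ : Measure ℝ) (a s : ℝ) : ℝ := ∫ x, knight s (x - a) ∂μ

lemma integrable_knight (s : ℝ) : Integrable (fun x => knight s (x - a)) μ :=
  Integrable.of_bound (Measurable.aestronglyMeasurable (by fun_prop)) |s|
    (Eventually.of_forall fun x => by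
      rw [Real.norm_of_nonneg (knight_nonneg _ _)]
      exact knight_le_abs _ _)

lemma meanKnight_le_abs (s : ℝ) : meanKnight μ a s ≤ |s| := by
  have := integral_mono (integrable_knight μ a s) (integrable_const |s|)
    fun x => knight_le_abs s (x - a)
  simpa [meanKnight] using this

lemma meanKnight_nonneg (μ : Measure ℝ) (s : ℝ) : 0 ≤ meanKnight μ a s :=
  integral_nonneg fun _ => knight_nonneg _ _

/-- The remainder lies between `0` and `|s|`. This trades a second moment for a mean with a small
factor, which makes the variance of the total remainder vanish. -/
lemma integral_knight_sq_le (s : ℝ) :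
    ∫ x, knight s (x - a) ^ 2 ∂μ ≤ |s| * meanKnight μ a s := by
  rw [meanKnight, ← integral_const_mul]
  refine integral_mono_of_nonneg (Eventually.of_forall fun x => sq_nonneg _)
    ((integrable_knight μ a s).const_mul _) (Eventually.of_forall fun x => ?_)
  simp only [sq]
  exact mul_le_mul_of_nonneg_right (knight_le_abs _ _) (knight_nonneg _ _)

lemma knight_mono {s s' : ℝ} (h : 0 ≤ s) (hs : s ≤ s') (r : ℝ) : knight s r ≤ knight s' r := by
  unfold knight leInd
  rcases max_cases (s - r) 0 with ⟨h1, h1'⟩ | ⟨h1, h1'⟩ <;>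
  rcases max_cases (s' - r) 0 with ⟨h2, h2'⟩ | ⟨h2, h2'⟩ <;>
  rw [h1, h2] <;> split_ifs <;> linarith

lemma knight_anti {s s' : ℝ} (h : s ≤ 0) (hs : s' ≤ s) (r : ℝ) : knight s r ≤ knight s' r := by
  unfold knight leInd
  rcases max_cases (s - r) 0 with ⟨h1, h1'⟩ | ⟨h1, h1'⟩ <;>
  rcases max_cases (s' - r) 0 with ⟨h2, h2'⟩ | ⟨h2, h2'⟩ <;>
  rw [h1, h2] <;> split_ifs <;> linarith

lemma meanKnight_rescale {n : ℕ} (hn : n ≠ 0) (w : ℝ) :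
    1 / (n : ℝ) * ∫ t in (0 : ℝ)..w, √(n : ℝ) * (cdf μ (a + t / √(n : ℝ)) - cdf μ a) =
      meanKnight μ a (w / √(n : ℝ)) := by
  have hn0 : (0 : ℝ) < n := by positivity
  have hs : √(n : ℝ) ≠ 0 := (Real.sqrt_pos.2 hn0).ne'
  rw [meanKnight, integral_knight, intervalIntegral.integral_const_mul,
    intervalIntegral.integral_comp_div (fun t => cdf μ (a + t) - cdf μ a) hs, zero_div, smul_eq_mul,
    ← mul_assoc, ← mul_assoc, mul_assoc (1 / (n : ℝ)), Real.mul_self_sqrt hn0.le,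
    one_div_mul_cancel hn0.ne', one_mul]

/-- Monotonicity interpolates between the points `1 / √n`, where the behaviour is known, so no
continuity of the density is needed. -/
lemma exists_meanKnight_le_of_nonneg {c : ℝ} (hc : 0 ≤ c) {G : ℝ → ℝ}
    (hmono : ∀ s s', 0 ≤ s → s ≤ s' → G s ≤ G s') (h0 : G 0 ≤ 0)
    (h : Tendsto (fun n : ℕ => n * G (1 / √(n : ℝ))) atTop (𝓝 c)) {ε : ℝ} (hε : 0 < ε) :
    ∃ η > 0, ∀ s, 0 ≤ s → s ≤ η → G s ≤ (c + ε) * s ^ 2 := by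
  have hr : Tendsto (fun n : ℕ => (c + ε / 2) * (1 + 1 / (n : ℝ))) atTop
      (𝓝 ((c + ε / 2) * (1 + 0))) :=
    (tendsto_const_nhds.add tendsto_one_div_atTop_nhds_zero_nat).const_mul _
  obtain ⟨N, hN⟩ := eventually_atTop.1
    ((h.eventually (gt_mem_nhds (show c < c + ε / 2 by linarith))).and
      ((hr.eventually (gt_mem_nhds (show (c + ε / 2) * (1 + 0) < c + ε by linarith))).and
        (eventually_gt_atTop 0)))
  -- For `s` below this value, `n = ⌊1 / s²⌋` exceeds `N`; then `s ≤ 1 / √n` and `1 / n ≤ (1 + 1 /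
  -- n) s²`.
  refine ⟨1 / √((N + 1 : ℕ) : ℝ), by positivity, fun s hs hsη => ?_⟩
  rcases hs.eq_or_lt with rfl | hs
  · simpa using h0
  have hinv : ((N + 1 : ℕ) : ℝ) ≤ 1 / s ^ 2 := by
    rw [le_div_iff₀ (by positivity), ← le_div_iff₀' (by positivity)]
    refine (pow_le_pow_left₀ hs.le hsη 2).trans_eq ?_
    rw [div_pow, Real.sq_sqrt (by positivity), one_pow]
  set n := ⌊1 / s ^ 2⌋₊ with hn
  have hNn : N + 1 ≤ n := Nat.le_floor hinv
  obtain ⟨h1, h2, h3⟩ := hN n (by omega)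
  have hn0 : (0 : ℝ) < n := by exact_mod_cast h3
  have hle : (n : ℝ) ≤ 1 / s ^ 2 := Nat.floor_le (by positivity)
  have hlt : 1 / s ^ 2 < n + 1 := Nat.lt_floor_add_one _
  have hsn : s ≤ 1 / √(n : ℝ) := by
    rw [le_div_iff₀ (by positivity)]
    rw [le_div_iff₀ (by positivity)] at hle
    refine abs_le_of_sq_le_sq' ?_ zero_le_one |>.2
    rw [mul_pow, Real.sq_sqrt hn0.le]
    linarith
  have h4 := hmono s _ hs.le hsn
  have h5 : G (1 / √(n : ℝ)) ≤ (c + ε / 2) / n := by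
    rw [le_div_iff₀ hn0]
    linarith
  have h6 : 1 / (n : ℝ) ≤ (1 + 1 / n) * s ^ 2 := by
    rw [div_lt_iff₀ (by positivity)] at hlt
    rw [div_le_iff₀ hn0]
    have : (1 + 1 / (n : ℝ)) * s ^ 2 * n = (n + 1) * s ^ 2 := by field_simp
    linarith
  calc G s ≤ (c + ε / 2) * (1 / n) := by rw [mul_one_div]; linarith
    _ ≤ (c + ε / 2) * ((1 + 1 / n) * s ^ 2) := by gcongr
    _ = (c + ε / 2) * (1 + 1 / n) * s ^ 2 := by ring
    _ ≤ (c + ε) * s ^ 2 := by gcongr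

lemma exists_meanKnight_le {c : ℝ} (hc : 0 ≤ c)
    (h : ∀ u : ℝ, Tendsto (fun n : ℕ => n * meanKnight μ a (u / √(n : ℝ))) atTop (𝓝 (c * u ^ 2)))
    {ε : ℝ} (hε : 0 < ε) : ∃ η > 0, ∀ s, |s| ≤ η → meanKnight μ a s ≤ (c + ε) * s ^ 2 := by
  have hz : meanKnight μ a 0 ≤ 0 := by simpa using meanKnight_le_abs μ a 0
  obtain ⟨η₁, hη₁, h1⟩ := exists_meanKnight_le_of_nonneg hc (G := meanKnight μ a)
    (fun s s' hs hs' => integral_mono (integrable_knight μ a s) (integrable_knight μ a s')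
      fun x => knight_mono hs hs' _) hz (by simpa using h 1) hε
  obtain ⟨η₂, hη₂, h2⟩ := exists_meanKnight_le_of_nonneg hc (G := fun s => meanKnight μ a (-s))
    (fun s s' hs hs' => integral_mono (integrable_knight μ a _) (integrable_knight μ a _)
      fun x => knight_anti (by linarith) (by linarith) _) (by simpa using hz)
      (by simpa [neg_div] using h (-1)) hε
  refine ⟨min η₁ η₂, lt_min hη₁ hη₂, fun s hs => ?_⟩
  rcases le_total 0 s with h0 | h0
  · exact h1 s h0 (((le_abs_self s).trans hs).trans (min_le_left _ _))
  · simpa using h2 (-s) (by linarith) (((neg_le_abs s).trans hs).trans (min_le_right _ _))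

end meanKnight


/-! ### Scores and the local form of the criterion -/

/-- The sum over `k` of the scores `1_{x ≤ aₖ} - τₖ`. -/
def totalScore {K : ℕ} (τ a : Fin K → ℝ) (x : ℝ) : ℝ := ∑ k, (leInd (x - a k) - τ k)

/-- The normalized score in the intercept `k`. -/
def interceptScore {K : ℕ} (τ a : Fin K → ℝ) (n : ℕ) (e : ℕ → ℝ) (k : Fin K) : ℝ :=
  (√(n : ℝ))⁻¹ * ∑ i : Fin n, (leInd (e i - a k) - τ k)

/-- The normalized score in the coefficient `j`. -/
def coefScore {n p K : ℕ} (τ a : Fin K → ℝ) (X : Matrix (Fin n) (Fin p) ℝ) (e : ℕ → ℝ)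
    (j : Fin p) : ℝ :=
  (√(n : ℝ))⁻¹ * ∑ i : Fin n, X i j * totalScore τ a (e i)

/-- The increment of the criterion from `(a, β)` to `(a + u₀ / √n, β + u / √n)`. -/
def lossIncrement {n p K : ℕ} (τ a : Fin K → ℝ) (X : Matrix (Fin n) (Fin p) ℝ) (β : Fin p → ℝ)
    (e : ℕ → ℝ) (u₀ : Fin K → ℝ) (u : Fin p → ℝ) : ℝ :=
  cqrLoss τ X (linearResponse X β e) (a + (√(n : ℝ))⁻¹ • u₀) (β + (√(n : ℝ))⁻¹ • u) -
    cqrLoss τ X (linearResponse X β e) a β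

/-- Knight's identity summed over all residuals. The shift of a residual is the same linear
predictor for every level apart from its intercept, so the slope part collects the scores of all
levels into `totalScore`. -/
lemma lossIncrement_eq {n p K : ℕ} (τ a : Fin K → ℝ) (X : Matrix (Fin n) (Fin p) ℝ)
    (β : Fin p → ℝ) (e : ℕ → ℝ) (u₀ : Fin K → ℝ) (u : Fin p → ℝ) :
    lossIncrement τ a X β e u₀ u =
      ∑ k, interceptScore τ a n e k * u₀ k + ∑ j, coefScore τ a X e j * u j +
        ∑ k, ∑ i : Fin n, knight ((u₀ k + ∑ j, X i j * u j) / √(n : ℝ)) (e i - a k) := by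
  have h : ∀ (k : Fin K) (i : Fin n),
      checkFun (τ k) (linearResponse X β e i - (a + (√(n : ℝ))⁻¹ • u₀) k -
        ∑ j, X i j * (β + (√(n : ℝ))⁻¹ • u) j) -
      checkFun (τ k) (linearResponse X β e i - a k - ∑ j, X i j * β j) =
      ((u₀ k + ∑ j, X i j * u j) / √(n : ℝ)) * (leInd (e i - a k) - τ k) +
        knight ((u₀ k + ∑ j, X i j * u j) / √(n : ℝ)) (e i - a k) := by
    intro k i
    rw [← checkFun_sub_sub]
    congr 2
    · simp only [linearResponse, Pi.add_apply, Pi.smul_apply, smul_eq_mul, mul_add,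
        Finset.sum_add_distrib, mul_left_comm _ (√(n : ℝ))⁻¹, ← Finset.mul_sum]
      ring
    · simp only [linearResponse]
      ring
  unfold lossIncrement cqrLoss
  simp only [← Finset.sum_sub_distrib, h, Finset.sum_add_distrib]
  congr 1
  have h1 : ∀ k, ∑ i : Fin n, (u₀ k + ∑ j, X i j * u j) / √(n : ℝ) * (leInd (e i - a k) - τ k) =
      interceptScore τ a n e k * u₀ k +
        ∑ i : Fin n, (∑ j, X i j * u j) * (√(n : ℝ))⁻¹ * (leInd (e i - a k) - τ k) := by
    intro k
    rw [interceptScore, Finset.mul_sum, Finset.sum_mul, ← Finset.sum_add_distrib]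
    refine Finset.sum_congr rfl fun i _ => ?_
    ring
  simp only [h1, Finset.sum_add_distrib]
  congr 1
  rw [Finset.sum_comm]
  simp only [coefScore, totalScore, Finset.mul_sum, Finset.sum_mul]
  rw [Finset.sum_comm (s := (Finset.univ : Finset (Fin p)))]
  refine Finset.sum_congr rfl fun i _ => ?_
  rw [Finset.sum_comm]
  refine Finset.sum_congr rfl fun j _ => Finset.sum_congr rfl fun k _ => ?_
  ring

/-! ### Consequences of the assumptions on the design -/

section design

variable {p : ℕ} {X : (n : ℕ) → Matrix (Fin n) (Fin p) ℝ} {C : Matrix (Fin p) (Fin p) ℝ}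

lemma tendsto_sum_sq_of_gram
    (hX : Tendsto (fun n : ℕ => (1 / (n : ℝ)) • ((X n)ᵀ * X n)) atTop (𝓝 C)) (u : Fin p → ℝ) :
    Tendsto (fun n => ∑ i : Fin n, ((∑ j, X n i j * u j) / √(n : ℝ)) ^ 2) atTop
      (𝓝 (u ⬝ᵥ (C *ᵥ u))) := by
  have hc : Continuous fun M : Matrix (Fin p) (Fin p) ℝ => u ⬝ᵥ (M *ᵥ u) := by fun_prop
  refine ((hc.tendsto C).comp hX).congr fun n => ?_
  simp only [Function.comp, Matrix.smul_mulVec, dotProduct_smul, smul_eq_mul, div_pow,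
    Real.sq_sqrt (Nat.cast_nonneg n), ← Finset.sum_div]
  rw [← Matrix.mulVec_mulVec, Matrix.dotProduct_mulVec, Matrix.vecMul_transpose, one_div_mul_eq_div]
  congr 1
  simp [dotProduct, Matrix.mulVec, sq]

lemma dotProduct_mulVec_single (C : Matrix (Fin p) (Fin p) ℝ) (j : Fin p) (t : ℝ) :
    Pi.single j t ⬝ᵥ (C *ᵥ Pi.single j t) = t ^ 2 * C j j := by
  rw [single_dotProduct, Matrix.mulVec, dotProduct_single]
  ring

lemma tendsto_sum_meanKnight {f : ℝ → ℝ} [IsProbabilityMeasure (densityLaw f)] {a : ℝ}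
    (hF : ∀ (u₀ : ℝ) (u : Fin p → ℝ),
      Tendsto
        (fun n : ℕ => (1 / (n : ℝ)) * ∑ i : Fin n, ∫ t in (0 : ℝ)..(u₀ + ∑ j, X n i j * u j),
          √(n : ℝ) * (cdf (densityLaw f) (a + t / √(n : ℝ)) - cdf (densityLaw f) a))
        atTop (𝓝 (1 / 2 * f a * (u₀ ^ 2 + u ⬝ᵥ (C *ᵥ u))))) (u₀ : ℝ) (u : Fin p → ℝ) :
    Tendsto (fun n : ℕ => ∑ i : Fin n,
      meanKnight (densityLaw f) a ((u₀ + ∑ j, X n i j * u j) / √(n : ℝ))) atTop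
        (𝓝 (1 / 2 * f a * (u₀ ^ 2 + u ⬝ᵥ (C *ᵥ u)))) := by
  refine (hF u₀ u).congr' ?_
  filter_upwards [eventually_ne_atTop 0] with n hn
  rw [Finset.mul_sum]
  exact Finset.sum_congr rfl fun i _ => meanKnight_rescale _ _ hn _

/-- The local condition on the distribution function forces the design to be uniformly
asymptotically negligible. -/
lemma eventually_abs_design_le {μ : Measure ℝ} [IsProbabilityMeasure μ] {a c : ℝ} (hc : 0 < c)
    (hX : Tendsto (fun n : ℕ => (1 / (n : ℝ)) • ((X n)ᵀ * X n)) atTop (𝓝 C))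
    (hF : ∀ (u₀ : ℝ) (u : Fin p → ℝ),
      Tendsto (fun n : ℕ => ∑ i : Fin n, meanKnight μ a ((u₀ + ∑ j, X n i j * u j) / √(n : ℝ)))
        atTop (𝓝 (c * (u₀ ^ 2 + u ⬝ᵥ (C *ᵥ u))))) (j : Fin p) {δ : ℝ} (hδ : 0 < δ) :
    ∀ᶠ n in atTop, ∀ i, |X n i j / √(n : ℝ)| ≤ δ := by
  have hs : ∀ (n : ℕ) (i : Fin n) (t : ℝ),
      ∑ l, X n i l * (Pi.single j t : Fin p → ℝ) l = X n i j * t := by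
    intro n i t
    simp [Pi.single_apply]
  -- Taking `u = 0` in the assumption gives the local quadratic bound; taking `u₀ = 0` and `u` along
  -- one axis gives the quadratic scaling.
  refine eventually_forall_abs_le_of_tendsto_sum (G := meanKnight μ a) (c := c) (v := C j j) hc
    (meanKnight_le_abs μ a) (fun ε hε => exists_meanKnight_le μ a hc.le (fun u => ?_) hε)
    (z := fun n i => X n i j / √(n : ℝ)) ?_ (fun t => ?_) hδ
  · simpa using hF u 0
  · have := tendsto_sum_sq_of_gram hX (Pi.single j 1)
    simpa only [hs, dotProduct_mulVec_single, mul_one, one_pow, one_mul] using this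
  · have := hF 0 (Pi.single j t)
    simp only [hs, dotProduct_mulVec_single, zero_add, zero_pow two_ne_zero] at this
    rw [mul_assoc]
    refine this.congr fun n => Finset.sum_congr rfl fun i _ => ?_
    rw [mul_comm, mul_div_assoc]

lemma eventually_abs_lin_le
    (hmax : ∀ j, ∀ δ > 0, ∀ᶠ n : ℕ in atTop, ∀ i, |X n i j / √(n : ℝ)| ≤ δ) (u₀ : ℝ)
    (u : Fin p → ℝ) {δ : ℝ} (hδ : 0 < δ) :
    ∀ᶠ n : ℕ in atTop, ∀ i, |(u₀ + ∑ j, X n i j * u j) / √(n : ℝ)| ≤ δ := by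
  set S := ∑ j, |u j| with hS
  have hS0 : 0 ≤ S := Finset.sum_nonneg fun _ _ => abs_nonneg _
  have h0 : Tendsto (fun n : ℕ => |u₀| / √(n : ℝ)) atTop (𝓝 0) :=
    tendsto_const_nhds.div_atTop (Real.tendsto_sqrt_atTop.comp tendsto_natCast_atTop_atTop)
  have hη : 0 < δ / 2 / (S + 1) := by positivity
  filter_upwards [eventually_all.2 fun j => hmax j _ hη,
    h0.eventually (gt_mem_nhds (half_pos hδ))] with n h1 h2 i
  rw [add_div, Finset.sum_div]
  refine (abs_add_le _ _).trans ?_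
  have h3 : |u₀ / √(n : ℝ)| = |u₀| / √(n : ℝ) := by
    rw [abs_div, abs_of_nonneg (Real.sqrt_nonneg _)]
  have h4 : |∑ j, X n i j * u j / √(n : ℝ)| ≤ ∑ j, δ / 2 / (S + 1) * |u j| := by
    refine (Finset.abs_sum_le_sum_abs _ _).trans (Finset.sum_le_sum fun j _ => ?_)
    rw [mul_div_right_comm, abs_mul]
    exact mul_le_mul_of_nonneg_right (h1 j i) (abs_nonneg _)
  rw [← Finset.mul_sum, ← hS] at h4
  have h5 : δ / 2 / (S + 1) * S ≤ δ / 2 := by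
    rw [div_mul_eq_mul_div, div_le_iff₀ (by positivity)]
    nlinarith
  linarith

end design

/-! ### Convergence in probability of the remainder -/

section stochastic

variable {Ω : Type*} [MeasurableSpace Ω] {P : Measure Ω} [IsProbabilityMeasure P]
  {μ : Measure ℝ} [IsProbabilityMeasure μ] {ε : ℕ → Ω → ℝ}

/-- The variance is at most the largest `|s n i|` times the total mean; the first factor tends to
zero and the second stays bounded. -/
lemma tendsto_whp_sum_knight (hlaw : ∀ i, HasLaw (ε i) μ P) (hind : iIndepFun ε P) {a L : ℝ}
    {s : (n : ℕ) → Fin n → ℝ} (hs : ∀ δ > 0, ∀ᶠ n in atTop, ∀ i, |s n i| ≤ δ)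
    (hL : Tendsto (fun n => ∑ i, meanKnight μ a (s n i)) atTop (𝓝 L)) :
    Tendsto (fun q : ℕ × Ω => ∑ i : Fin q.1, knight (s q.1 i) (ε i q.2 - a)) (whp P) (𝓝 L) := by
  refine tendsto_whp_of_deviation (T := fun n ω => ∑ i : Fin n, knight (s n i) (ε i ω - a))
    (V := fun n => ∑ i, |s n i| * meanKnight μ a (s n i)) hL ?_ fun n M hM => ?_
  · rw [Metric.tendsto_nhds]
    intro r hr
    have hL0 : 0 ≤ L := ge_of_tendsto' hL fun n =>
      Finset.sum_nonneg fun i _ => meanKnight_nonneg _ _ _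
    filter_upwards [hs (r / (L + 2)) (by positivity), hL.eventually (gt_mem_nhds (lt_add_one L))]
      with n h1 h2
    rw [Real.dist_0_eq_abs, abs_of_nonneg (Finset.sum_nonneg fun i _ =>
      mul_nonneg (abs_nonneg _) (meanKnight_nonneg _ _ _))]
    calc _ ≤ ∑ i, r / (L + 2) * meanKnight μ a (s n i) := Finset.sum_le_sum fun i _ =>
          mul_le_mul_of_nonneg_right (h1 i) (meanKnight_nonneg _ _ _)
      _ = r / (L + 2) * ∑ i, meanKnight μ a (s n i) := by rw [Finset.mul_sum]
      _ < r := by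
          rw [div_mul_eq_mul_div, div_lt_iff₀ (by positivity)]
          nlinarith
  · refine (measure_le_abs_sum_sub_le hlaw hind (g := fun i x => knight (s n i) (x - a))
      (fun i => by fun_prop) (B := fun i => |s n i|) (fun i x => ?_) hM).trans
      (ENNReal.ofReal_le_ofReal ?_)
    · rw [abs_of_nonneg (knight_nonneg _ _)]
      exact knight_le_abs _ _
    · gcongr with i
      exact integral_knight_sq_le _ _ _

lemma measure_le_abs_weighted_sum_le (hlaw : ∀ i, HasLaw (ε i) μ P) (hind : iIndepFun ε P)
    {g : ℝ → ℝ} (hg : Measurable g) {B : ℝ} (hB : ∀ x, |g x| ≤ B) (h0 : ∫ x, g x ∂μ = 0) {n : ℕ}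
    (c : Fin n → ℝ) {M : ℝ} (hM : 0 < M) :
    P {ω | M ≤ |∑ i, c i * g (ε i ω)|} ≤ ENNReal.ofReal (B ^ 2 * (∑ i, c i ^ 2) / M ^ 2) := by
  have h := measure_le_abs_sum_sub_le hlaw hind (g := fun i x => c i * g x)
    (fun i => by fun_prop) (B := fun i => |c i| * B) (fun i x => by
      rw [abs_mul]
      exact mul_le_mul_of_nonneg_left (hB x) (abs_nonneg _)) hM
  simp only [integral_const_mul, h0, mul_zero, Finset.sum_const_zero, sub_zero] at h
  refine h.trans (ENNReal.ofReal_le_ofReal ?_)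
  gcongr
  rw [Finset.mul_sum]
  refine Finset.sum_le_sum fun i _ => ?_
  simp only [mul_pow]
  rw [integral_const_mul, mul_comm]
  gcongr
  have hb := integral_mono_of_nonneg (μ := μ) (f := fun x => g x ^ 2) (g := fun _ => B ^ 2)
    (Eventually.of_forall fun x => sq_nonneg _) (integrable_const _)
    (Eventually.of_forall fun x => by
      simp only
      rw [← sq_abs]
      exact pow_le_pow_left₀ (abs_nonneg _) (hB x) 2)
  simpa using hb

end stochastic

/-! ### Moments and tightness of the scores; quadratic expansion -/

section scores

variable {K : ℕ} {τ a : Fin K → ℝ} {μ : Measure ℝ} [IsProbabilityMeasure μ]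

@[fun_prop]
lemma measurable_totalScore : Measurable (totalScore τ a) := by
  unfold totalScore
  fun_prop

lemma abs_leInd_sub_le {t : ℝ} (h0 : 0 < t) (h1 : t < 1) (r : ℝ) : |leInd r - t| ≤ 1 := by
  have := leInd_nonneg r
  have := leInd_le_one r
  rw [abs_le]
  constructor <;> linarith

lemma abs_totalScore_le (h0 : ∀ k, 0 < τ k) (h1 : ∀ k, τ k < 1) (x : ℝ) :
    |totalScore τ a x| ≤ K := by
  refine (Finset.abs_sum_le_sum_abs _ _).trans ?_
  refine (Finset.sum_le_sum fun k _ => abs_leInd_sub_le (h0 k) (h1 k) _).trans ?_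
  simp

lemma integrable_leInd_sub (b : ℝ) : Integrable (fun x => leInd (x - b)) μ :=
  Integrable.of_bound (Measurable.aestronglyMeasurable (by fun_prop)) 1
    (Eventually.of_forall fun x => by
      rw [Real.norm_of_nonneg (leInd_nonneg _)]
      exact leInd_le_one _)

lemma integral_totalScore (ha : ∀ k, cdf μ (a k) = τ k) : ∫ x, totalScore τ a x ∂μ = 0 := by
  unfold totalScore
  have hi : ∀ k, Integrable (fun x => leInd (x - a k) - τ k) μ := fun k =>
    (integrable_leInd_sub _).sub (integrable_const _)
  rw [integral_finsetSum _ fun k _ => hi k]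
  refine Finset.sum_eq_zero fun k _ => ?_
  rw [integral_sub (integrable_leInd_sub _) (integrable_const _), integral_leInd_sub, ha]
  simp

lemma leInd_mul_leInd (x b b' : ℝ) : leInd (x - b) * leInd (x - b') = leInd (x - min b b') := by
  unfold leInd
  simp only [sub_nonpos, le_min_iff]
  by_cases h : x ≤ b <;> by_cases h' : x ≤ b' <;> simp [h, h']

/-- A product of two indicators is the indicator at the smaller quantile, so the covariance of two
scores is `min - τ τ'`; writing `τ τ'` as `min * max` gives the stated form. -/
lemma integral_totalScore_sq (ha : ∀ k, cdf μ (a k) = τ k) :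
    ∫ x, totalScore τ a x ^ 2 ∂μ = ∑ k, ∑ k', min (τ k) (τ k') * (1 - max (τ k) (τ k')) := by
  have h : ∀ x, totalScore τ a x ^ 2 = ∑ k, ∑ k', (leInd (x - min (a k) (a k')) -
      τ k' * leInd (x - a k) - τ k * leInd (x - a k') + τ k * τ k') := by
    intro x
    rw [totalScore, sq, Finset.sum_mul_sum]
    refine Finset.sum_congr rfl fun k _ => Finset.sum_congr rfl fun k' _ => ?_
    rw [← leInd_mul_leInd]
    ring
  have hi1 : ∀ k k', Integrable (fun x => leInd (x - min (a k) (a k')) -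
      τ k' * leInd (x - a k)) μ := fun k k' =>
    (integrable_leInd_sub _).sub ((integrable_leInd_sub _).const_mul _)
  have hi2 : ∀ k k', Integrable (fun x => leInd (x - min (a k) (a k')) -
      τ k' * leInd (x - a k) - τ k * leInd (x - a k')) μ := fun k k' =>
    (hi1 k k').sub ((integrable_leInd_sub _).const_mul _)
  have hi : ∀ k k', Integrable (fun x => leInd (x - min (a k) (a k')) -
      τ k' * leInd (x - a k) - τ k * leInd (x - a k') + τ k * τ k') μ := fun k k' =>
    (hi2 k k').add (integrable_const _)
  simp only [h]
  rw [integral_finsetSum _ fun k _ => integrable_finsetSum _ fun k' _ => hi k k']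
  refine Finset.sum_congr rfl fun k _ => ?_
  rw [integral_finsetSum _ fun k' _ => hi k k']
  refine Finset.sum_congr rfl fun k' _ => ?_
  rw [integral_add (hi2 k k') (integrable_const _),
    integral_sub (hi1 k k') ((integrable_leInd_sub _).const_mul _),
    integral_sub (integrable_leInd_sub _) ((integrable_leInd_sub _).const_mul _),
    integral_const_mul, integral_const_mul, integral_leInd_sub, integral_leInd_sub,
    integral_leInd_sub, (monotone_cdf μ).map_min, ha, ha]
  have := min_mul_max (τ k) (τ k')
  simp only [integral_const, probReal_univ, one_smul]
  linear_combination this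

variable {Ω : Type*} [MeasurableSpace Ω] {P : Measure Ω} [IsProbabilityMeasure P]
  {ε : ℕ → Ω → ℝ} {p : ℕ} {X : (n : ℕ) → Matrix (Fin n) (Fin p) ℝ} {C : Matrix (Fin p) (Fin p) ℝ}

/-- The scores are tight by Chebyshev's inequality. This reduces every later statement to a
deterministic one along filters on which they are bounded. -/
lemma mem_whp_of_forall_scores_bounded (h0 : ∀ k, 0 < τ k) (h1 : ∀ k, τ k < 1)
    (ha : ∀ k, cdf μ (a k) = τ k) (hlaw : ∀ i, HasLaw (ε i) μ P) (hind : iIndepFun ε P)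
    (hX : Tendsto (fun n : ℕ => (1 / (n : ℝ)) • ((X n)ᵀ * X n)) atTop (𝓝 C)) {s : Set (ℕ × Ω)}
    (hs : ∀ l ≤ whp P, ∀ M : ℝ,
      (∀ᶠ q : ℕ × Ω in l, ∀ k, |interceptScore τ a q.1 (fun i => ε i q.2) k| ≤ M) →
      (∀ᶠ q : ℕ × Ω in l, ∀ j, |coefScore τ a (X q.1) (fun i => ε i q.2) j| ≤ M) → s ∈ l) :
    s ∈ whp P := by
  -- One variance bound serves all coordinates: `1` for an intercept and, eventually, `K ^ 2 * (C j
  -- j + 1)` for the coefficient `j`.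
  refine mem_whp_of_tight (W := fun n ω => (Sum.elim (interceptScore τ a n fun i => ε i ω)
    (coefScore τ a (X n) fun i => ε i ω) : Fin K ⊕ Fin p → ℝ))
    (exists_forall_measure_norm_le (V := 1 + ∑ j, K ^ 2 * (C j j + 1)) ?_) fun M => ?_
  · have hC : ∀ j, 0 ≤ C j j := fun j => ge_of_tendsto'
      (by simpa [dotProduct_mulVec_single] using tendsto_sum_sq_of_gram hX (Pi.single j 1))
      fun n => Finset.sum_nonneg fun i _ => sq_nonneg _
    have hsum : ∀ j, 0 ≤ (K : ℝ) ^ 2 * (C j j + 1) := fun j => by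
      have := hC j
      positivity
    rintro (k | j)
    · filter_upwards [eventually_ne_atTop 0] with n hn M hM
      have hn0 : (0 : ℝ) < n := by positivity
      have h := measure_le_abs_weighted_sum_le hlaw hind
        (g := fun x => leInd (x - a k) - τ k) (by fun_prop)
        (fun x => abs_leInd_sub_le (h0 k) (h1 k) _)
        (by rw [integral_sub (integrable_leInd_sub _) (integrable_const _), integral_leInd_sub, ha]
            simp) (n := n) (fun _ => (√(n : ℝ))⁻¹) hM
      simp only [Sum.elim_inl, interceptScore, Finset.mul_sum]
      refine h.trans (ENNReal.ofReal_le_ofReal ?_)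
      have : ∑ _i : Fin n, ((√(n : ℝ))⁻¹) ^ 2 = 1 := by
        simp [inv_pow, Real.sq_sqrt hn0.le, hn0.ne']
      rw [this]
      have := Finset.sum_nonneg fun j (_ : j ∈ Finset.univ) => hsum j
      gcongr
      linarith
    · have ht := tendsto_sum_sq_of_gram hX (Pi.single j 1)
      simp only [dotProduct_mulVec_single, one_pow, one_mul] at ht
      filter_upwards [ht.eventually (gt_mem_nhds (lt_add_one (C j j)))] with n hn M hM
      have h := measure_le_abs_weighted_sum_le hlaw hind (g := totalScore τ a) (by fun_prop)
        (abs_totalScore_le h0 h1) (integral_totalScore ha) (n := n)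
        (fun i => X n i j / √(n : ℝ)) hM
      have e : ∀ ω, coefScore τ a (X n) (fun i => ε i ω) j =
          ∑ i : Fin n, X n i j / √(n : ℝ) * totalScore τ a (ε i ω) := by
        intro ω
        rw [coefScore, Finset.mul_sum]
        refine Finset.sum_congr rfl fun i _ => ?_
        ring
      simp only [Sum.elim_inr, e]
      refine h.trans (ENNReal.ofReal_le_ofReal ?_)
      have hle : ∑ i : Fin n, (X n i j / √(n : ℝ)) ^ 2 ≤ C j j + 1 := by
        simpa [Pi.single_apply] using hn.le
      have := Finset.single_le_sum (fun j _ => hsum j) (Finset.mem_univ j)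
      gcongr
      nlinarith [sq_nonneg (K : ℝ)]
  · refine hs _ inf_le_left M ?_ ?_
    · filter_upwards [mem_inf_of_right (mem_principal_self _)] with q hq k
      exact (norm_le_pi_norm (Sum.elim (interceptScore τ a q.1 fun i => ε i q.2)
        (coefScore τ a (X q.1) fun i => ε i q.2)) (Sum.inl k)).trans hq
    · filter_upwards [mem_inf_of_right (mem_principal_self _)] with q hq j
      exact (norm_le_pi_norm (Sum.elim (interceptScore τ a q.1 fun i => ε i q.2)
        (coefScore τ a (X q.1) fun i => ε i q.2)) (Sum.inr j)).trans hq

/-- The local quadratic expansion of the criterion. -/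
lemma tendsto_whp_lossIncrement {c : Fin K → ℝ}
    (hlaw : ∀ i, HasLaw (ε i) μ P) (hind : iIndepFun ε P)
    (hmax : ∀ j, ∀ δ > 0, ∀ᶠ n : ℕ in atTop, ∀ i, |X n i j / √(n : ℝ)| ≤ δ)
    (hF : ∀ (k : Fin K) (u₀ : ℝ) (u : Fin p → ℝ),
      Tendsto (fun n : ℕ => ∑ i : Fin n, meanKnight μ (a k) ((u₀ + ∑ j, X n i j * u j) / √(n : ℝ)))
        atTop (𝓝 (c k * (u₀ ^ 2 + u ⬝ᵥ (C *ᵥ u))))) (β : Fin p → ℝ)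
    (u₀ : Fin K → ℝ) (u : Fin p → ℝ) :
    Tendsto (fun q : ℕ × Ω => lossIncrement τ a (X q.1) β (fun i => ε i q.2) u₀ u -
      (∑ k, interceptScore τ a q.1 (fun i => ε i q.2) k * u₀ k +
        ∑ j, coefScore τ a (X q.1) (fun i => ε i q.2) j * u j)) (whp P)
      (𝓝 (∑ k, c k * (u₀ k ^ 2 + u ⬝ᵥ (C *ᵥ u)))) := by
  simp only [lossIncrement_eq, add_sub_cancel_left]
  refine tendsto_finsetSum _ fun k _ => ?_
  exact tendsto_whp_sum_knight hlaw hind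
    (s := fun n i => (u₀ k + ∑ j, X n i j * u j) / √(n : ℝ))
    (fun δ hδ => eventually_abs_lin_le hmax _ _ hδ) (hF k (u₀ k) u)

end scores


/-! ### Convexity of the criterion -/

lemma checkFun_convex_comb {τ x y : ℝ} (hx : 0 ≤ x) (hy : 0 ≤ y) (s t : ℝ) :
    checkFun τ (x * s + y * t) ≤ x * checkFun τ s + y * checkFun τ t := by
  simp only [checkFun_eq]
  have h : max (-(x * s + y * t)) 0 ≤ x * max (-s) 0 + y * max (-t) 0 := by
    have h1 := mul_le_mul_of_nonneg_left (le_max_left (-s) 0) hx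
    have h2 := mul_le_mul_of_nonneg_left (le_max_left (-t) 0) hy
    exact max_le (by linarith) (by positivity)
  linarith

lemma abs_checkFun_sub_le {τ : ℝ} (h0 : 0 < τ) (h1 : τ < 1) (s t : ℝ) :
    checkFun τ s - checkFun τ t ≤ |s - t| := by
  unfold checkFun
  rcases max_cases s 0 with ⟨h2, h2'⟩ | ⟨h2, h2'⟩ <;>
  rcases max_cases (-s) 0 with ⟨h3, h3'⟩ | ⟨h3, h3'⟩ <;>
  rcases max_cases t 0 with ⟨h4, h4'⟩ | ⟨h4, h4'⟩ <;>
  rcases max_cases (-t) 0 with ⟨h5, h5'⟩ | ⟨h5, h5'⟩ <;>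
  rcases abs_cases (s - t) with ⟨h6, h6'⟩ | ⟨h6, h6'⟩ <;>
  rw [h2, h3, h4, h5, h6] <;> nlinarith

lemma convexOn_cqrLoss {n p K : ℕ} (τ : Fin K → ℝ) (X : Matrix (Fin n) (Fin p) ℝ)
    (y : Fin n → ℝ) :
    ConvexOn ℝ Set.univ fun θ : (Fin K → ℝ) × (Fin p → ℝ) => cqrLoss τ X y θ.1 θ.2 := by
  refine ⟨convex_univ, fun θ _ θ' _ r s hr hs hrs => ?_⟩
  simp only [cqrLoss, smul_eq_mul, Finset.mul_sum, ← Finset.sum_add_distrib]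
  refine Finset.sum_le_sum fun k _ => Finset.sum_le_sum fun i _ => ?_
  refine le_trans (le_of_eq ?_) (checkFun_convex_comb hr hs _ _)
  congr 1
  have e : ∑ j, X i j * (r • θ + s • θ').2 j = r * ∑ j, X i j * θ.2 j + s * ∑ j, X i j * θ'.2 j := by
    simp only [Prod.snd_add, Prod.smul_snd, Pi.add_apply, Pi.smul_apply, smul_eq_mul,
      Finset.mul_sum, ← Finset.sum_add_distrib]
    exact Finset.sum_congr rfl fun j _ => by ring
  rw [e]
  simp only [Prod.fst_add, Prod.smul_fst, Pi.add_apply, Pi.smul_apply, smul_eq_mul]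
  linear_combination y i * (-hrs)

lemma convexOn_lossIncrement {n p K : ℕ} (τ a : Fin K → ℝ) (X : Matrix (Fin n) (Fin p) ℝ)
    (β : Fin p → ℝ) (e : ℕ → ℝ) :
    ConvexOn ℝ Set.univ fun θ : (Fin K → ℝ) × (Fin p → ℝ) => lossIncrement τ a X β e θ.1 θ.2 := by
  refine ⟨convex_univ, fun θ _ θ' _ r s hr hs hrs => ?_⟩
  have h := (convexOn_cqrLoss τ X (linearResponse X β e)).2
    (Set.mem_univ (a + (√(n : ℝ))⁻¹ • θ.1, β + (√(n : ℝ))⁻¹ • θ.2))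
    (Set.mem_univ (a + (√(n : ℝ))⁻¹ • θ'.1, β + (√(n : ℝ))⁻¹ • θ'.2)) hr hs hrs
  have e1 : a + (√(n : ℝ))⁻¹ • (r • θ + s • θ').1 =
      r • (a + (√(n : ℝ))⁻¹ • θ.1) + s • (a + (√(n : ℝ))⁻¹ • θ'.1) := by
    ext k
    simp only [Prod.fst_add, Prod.smul_fst, Pi.add_apply, Pi.smul_apply, smul_eq_mul]
    linear_combination a k * (-hrs)
  have e2 : β + (√(n : ℝ))⁻¹ • (r • θ + s • θ').2 =
      r • (β + (√(n : ℝ))⁻¹ • θ.2) + s • (β + (√(n : ℝ))⁻¹ • θ'.2) := by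
    ext k
    simp only [Prod.snd_add, Prod.smul_snd, Pi.add_apply, Pi.smul_apply, smul_eq_mul]
    linear_combination β k * (-hrs)
  simp only [lossIncrement, e1, e2]
  simp only [smul_eq_mul, Prod.smul_mk, Prod.mk_add_mk] at h ⊢
  linear_combination h + cqrLoss τ X (linearResponse X β e) a β * hrs

lemma lossIncrement_rescaled {n p K : ℕ} (hn : n ≠ 0) (τ a : Fin K → ℝ)
    (X : Matrix (Fin n) (Fin p) ℝ) (β : Fin p → ℝ) (e : ℕ → ℝ) (b : Fin K → ℝ) (β' : Fin p → ℝ) :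
    lossIncrement τ a X β e (√(n : ℝ) • (b - a)) (√(n : ℝ) • (β' - β)) =
      cqrLoss τ X (linearResponse X β e) b β' - cqrLoss τ X (linearResponse X β e) a β := by
  have hs : √(n : ℝ) ≠ 0 := by positivity
  simp only [lossIncrement, smul_smul, inv_mul_cancel₀ hs, one_smul, add_sub_cancel]

/-! ### Minimization over vectors with a prescribed support -/

/-- Extension of a vector by zero outside of `S`. -/
def extendZero {p : ℕ} (S : Finset (Fin p)) : (S → ℝ) →ₗ[ℝ] (Fin p → ℝ) where
  toFun v j := if h : j ∈ S then v ⟨j, h⟩ else 0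
  map_add' v w := by
    ext j
    by_cases h : j ∈ S <;> simp [h]
  map_smul' r v := by
    ext j
    by_cases h : j ∈ S <;> simp [h]

section extendZero

variable {p : ℕ} (S : Finset (Fin p))

lemma extendZero_of_mem (v : S → ℝ) (j : S) : extendZero S v j = v j := by
  simp [extendZero]

lemma extendZero_of_notMem (v : S → ℝ) {j : Fin p} (hj : j ∉ S) : extendZero S v j = 0 := by
  simp [extendZero, hj]

lemma extendZero_restrict {u : Fin p → ℝ} (hu : ∀ j ∉ S, u j = 0) :
    extendZero S (fun j => u j) = u := by
  ext j
  by_cases h : j ∈ S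
  · exact extendZero_of_mem S _ ⟨j, h⟩
  · rw [extendZero_of_notMem S _ h, hu j h]

lemma sum_eq_sum_coe_of_support (g : Fin p → ℝ) (hg : ∀ j ∉ S, g j = 0) :
    ∑ j, g j = ∑ j : S, g j := by
  rw [Finset.sum_coe_sort S g]
  exact (Finset.sum_subset (Finset.subset_univ S) fun j _ hj => hg j hj).symm

lemma dotProduct_extendZero (w : Fin p → ℝ) (v : S → ℝ) :
    ∑ j, w j * extendZero S v j = (fun j : S => w j) ⬝ᵥ v := by
  rw [sum_eq_sum_coe_of_support S _ fun j hj => by rw [extendZero_of_notMem S v hj, mul_zero]]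
  simp only [extendZero_of_mem, dotProduct]

lemma extendZero_quadratic (C : Matrix (Fin p) (Fin p) ℝ) (v : S → ℝ) :
    extendZero S v ⬝ᵥ (C *ᵥ extendZero S v) =
      v ⬝ᵥ (C.submatrix (fun j : S => (j : Fin p)) (fun j : S => (j : Fin p)) *ᵥ v) := by
  rw [dotProduct_comm, dotProduct, dotProduct_extendZero, dotProduct_comm]
  congr 1
  ext i
  rw [Matrix.mulVec, dotProduct, dotProduct_extendZero]
  rfl

end extendZero

/-- Minimization of a positive definite quadratic form plus a linear form. -/
lemma quadratic_completion {ι : Type*} [Fintype ι] [DecidableEq ι] {B : Matrix ι ι ℝ}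
    (hB : B.PosDef) {F : ℝ} (hF : 0 < F) (w v : ι → ℝ) :
    w ⬝ᵥ v + F * (v ⬝ᵥ (B *ᵥ v)) =
      F * ((v + (2 * F)⁻¹ • (B⁻¹ *ᵥ w)) ⬝ᵥ (B *ᵥ (v + (2 * F)⁻¹ • (B⁻¹ *ᵥ w)))) -
        (4 * F)⁻¹ * (w ⬝ᵥ (B⁻¹ *ᵥ w)) := by
  have hdet : IsUnit B.det := hB.det_pos.ne'.isUnit
  have h1 : B *ᵥ (B⁻¹ *ᵥ w) = w := by
    rw [Matrix.mulVec_mulVec, Matrix.mul_nonsing_inv _ hdet, Matrix.one_mulVec]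
  have h2 : (B⁻¹ *ᵥ w) ⬝ᵥ (B *ᵥ v) = w ⬝ᵥ v := by
    have hs : Bᵀ = B := by simpa [Matrix.IsHermitian] using hB.isHermitian
    rw [Matrix.dotProduct_mulVec, ← Matrix.mulVec_transpose, hs, h1]
  rw [Matrix.mulVec_add, Matrix.mulVec_smul, h1]
  simp only [add_dotProduct, dotProduct_add, smul_dotProduct, dotProduct_smul, smul_eq_mul, h2]
  rw [dotProduct_comm v w, dotProduct_comm (B⁻¹ *ᵥ w) w]
  field_simp
  ring

/-- Minimizers of convex criteria with a local quadratic expansion, over the vectors supported in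
`S` and up to a vanishing convex penalty. -/
theorem tendsto_restricted_argmin {α : Type*} {l : Filter α} {K p : ℕ} (hK : 0 < K)
    {D : α → (Fin K → ℝ) → (Fin p → ℝ) → ℝ} {W₀ : α → Fin K → ℝ} {W : α → Fin p → ℝ}
    {c : Fin K → ℝ} (hc : ∀ k, 0 < c k) {C : Matrix (Fin p) (Fin p) ℝ} (hC : C.PosDef)
    (hD : ∀ u₀ u, Tendsto (fun q => D q u₀ u - (∑ k, W₀ q k * u₀ k + ∑ j, W q j * u j)) l
      (𝓝 (∑ k, c k * (u₀ k ^ 2 + u ⬝ᵥ (C *ᵥ u)))))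
    (hconv : ∀ q, ConvexOn ℝ Set.univ fun θ : (Fin K → ℝ) × (Fin p → ℝ) => D q θ.1 θ.2)
    {M : ℝ} (hW₀ : ∀ᶠ q in l, ∀ k, |W₀ q k| ≤ M) (hW : ∀ᶠ q in l, ∀ j, |W q j| ≤ M)
    (S : Finset (Fin p)) {pen : α → (S → ℝ) → ℝ} (hpen : ∀ v, Tendsto (fun q => pen q v) l (𝓝 0))
    (hpconv : ∀ᶠ q in l, ConvexOn ℝ Set.univ (pen q)) {b : α → Fin K → ℝ} {x : α → S → ℝ}
    (hmin : ∀ᶠ q in l, ∀ u₀ v, D q (b q) (extendZero S (x q)) + pen q (x q) ≤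
      D q u₀ (extendZero S v) + pen q v) :
    Tendsto (fun q => x q + (2 * ∑ k, c k)⁻¹ •
      ((C.submatrix (fun j : S => (j : Fin p)) (fun j : S => (j : Fin p)))⁻¹ *ᵥ
        fun j : S => W q j)) l (𝓝 0) := by
  set B := C.submatrix (fun j : S => (j : Fin p)) (fun j : S => (j : Fin p)) with hBdef
  have hB : B.PosDef := hC.submatrix Subtype.val_injective
  have hF : 0 < ∑ k, c k := by
    have : Nonempty (Fin K) := ⟨⟨0, hK⟩⟩
    exact Finset.sum_pos (fun k _ => hc k) Finset.univ_nonempty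
  set F := ∑ k, c k with hFdef
  rw [tendsto_iff_ultrafilter]
  intro g hg
  -- The scores need only be bounded: along an ultrafilter they converge by compactness, and the
  -- claim concerns the difference between the minimizer and a continuous function of them.
  have hbd : ∀ {ι : Type} [Fintype ι] {V : α → ι → ℝ}, (∀ᶠ q in l, ∀ i, |V q i| ≤ M) →
      ∃ w, Tendsto V g (𝓝 w) := by
    intro ι _ V hV
    obtain ⟨w, -, hw⟩ := (isCompact_univ_pi fun _ : ι => isCompact_Icc (a := -M) (b := M))
      |>.ultrafilter_le_nhds (g.map V) (le_principal_iff.2 (hg (hV.mono fun q hq i _ =>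
        abs_le.1 (hq i))))
    exact ⟨w, hw⟩
  obtain ⟨w₀, hw₀⟩ := hbd hW₀
  obtain ⟨w, hw⟩ := hbd hW
  let wS : S → ℝ := fun j => w j
  -- The minimizer of the limit, found by completing squares separately in the intercepts and in the
  -- slopes.
  let m : (Fin K → ℝ) × (S → ℝ) := (fun k => -(w₀ k / (2 * c k)), -((2 * F)⁻¹ • (B⁻¹ *ᵥ wS)))
  let h : (Fin K → ℝ) × (S → ℝ) → ℝ := fun θ =>
    ∑ k, (c k * (θ.1 k - m.1 k) ^ 2 - w₀ k ^ 2 / (4 * c k)) +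
      (F * ((θ.2 - m.2) ⬝ᵥ (B *ᵥ (θ.2 - m.2))) - (4 * F)⁻¹ * (wS ⬝ᵥ (B⁻¹ *ᵥ wS)))
  have hh : ∀ θ : (Fin K → ℝ) × (S → ℝ), ∑ k, w₀ k * θ.1 k + ∑ j, w j * extendZero S θ.2 j +
      ∑ k, c k * (θ.1 k ^ 2 + extendZero S θ.2 ⬝ᵥ (C *ᵥ extendZero S θ.2)) = h θ := by
    intro θ
    have h1 := quadratic_completion hB hF wS θ.2
    simp only [h, m, sub_neg_eq_add]
    rw [← h1, extendZero_quadratic, dotProduct_extendZero]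
    simp only [mul_add, Finset.sum_add_distrib, ← Finset.sum_mul]
    have h2 : ∑ k, (c k * (θ.1 k + w₀ k / (2 * c k)) ^ 2 - w₀ k ^ 2 / (4 * c k)) =
        ∑ k, w₀ k * θ.1 k + ∑ k, c k * θ.1 k ^ 2 := by
      rw [← Finset.sum_add_distrib]
      refine Finset.sum_congr rfl fun k _ => ?_
      have := (hc k).ne'
      field_simp
      ring
    rw [h2]
    ring
  have hlim : Tendsto (fun q => (b q, x q)) g (𝓝 m) := by
    refine tendsto_argmin_of_convexOn
      (H := fun q θ => D q θ.1 (extendZero S θ.2) + pen q θ.2) (h := h) ?_ ?_ ?_ ?_ ?_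
    · filter_upwards [hpconv.filter_mono hg] with q hq
      exact ((hconv q).comp_linearMap (LinearMap.prodMap LinearMap.id (extendZero S))).add
        (hq.comp_linearMap (LinearMap.snd ℝ (Fin K → ℝ) (S → ℝ)))
    · intro θ
      have h1 := (hD θ.1 (extendZero S θ.2)).mono_left hg
      have h2 : Tendsto (fun q => ∑ k, W₀ q k * θ.1 k) g (𝓝 (∑ k, w₀ k * θ.1 k)) :=
        tendsto_finsetSum _ fun k _ => ((tendsto_pi_nhds.1 hw₀) k).mul_const _
      have h3 : Tendsto (fun q => ∑ j, W q j * extendZero S θ.2 j) g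
          (𝓝 (∑ j, w j * extendZero S θ.2 j)) :=
        tendsto_finsetSum _ fun k _ => ((tendsto_pi_nhds.1 hw) k).mul_const _
      have h4 := ((h2.add h3).add h1).add ((hpen θ.2).mono_left hg)
      rw [hh, add_zero] at h4
      exact h4.congr fun q => by ring
    · simp only [h]
      fun_prop
    · intro θ hθ
      have h1 : ∀ k, 0 ≤ c k * (θ.1 k - m.1 k) ^ 2 := fun k =>
        mul_nonneg (hc k).le (sq_nonneg _)
      have h2 : 0 ≤ (θ.2 - m.2) ⬝ᵥ (B *ᵥ (θ.2 - m.2)) := by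
        simpa using hB.posSemidef.dotProduct_mulVec_nonneg (θ.2 - m.2)
      simp only [h, sub_self, Finset.sum_sub_distrib, zero_dotProduct, mul_zero, ne_eq,
        OfNat.ofNat_ne_zero, not_false_eq_true, zero_pow, Finset.sum_const_zero]
      have h3 : 0 < ∑ k, c k * (θ.1 k - m.1 k) ^ 2 +
          F * ((θ.2 - m.2) ⬝ᵥ (B *ᵥ (θ.2 - m.2))) := by
        by_cases he : θ.2 = m.2
        · have hne : θ.1 ≠ m.1 := fun h => hθ (Prod.ext h he)
          obtain ⟨k, hk⟩ := Function.ne_iff.1 hne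
          refine add_pos_of_pos_of_nonneg ?_ (mul_nonneg hF.le h2)
          refine Finset.sum_pos' (fun k _ => h1 k) ⟨k, Finset.mem_univ k, ?_⟩
          exact mul_pos (hc k) (sq_pos_of_ne_zero (sub_ne_zero.2 hk))
        · refine add_pos_of_nonneg_of_pos (Finset.sum_nonneg fun k _ => h1 k) (mul_pos hF ?_)
          simpa using hB.dotProduct_mulVec_pos (sub_ne_zero.2 he)
      linarith
    · filter_upwards [hmin.filter_mono hg] with q hq θ
      exact hq θ.1 θ.2
  have hx : Tendsto x g (𝓝 m.2) := (continuous_snd.tendsto m).comp hlim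
  have hwS : Tendsto (fun q => fun j : S => W q j) g (𝓝 wS) :=
    tendsto_pi_nhds.2 fun j => (tendsto_pi_nhds.1 hw) j
  have hcont : Continuous fun z : S → ℝ => (2 * F)⁻¹ • (B⁻¹ *ᵥ z) := by fun_prop
  have := hx.add ((hcont.tendsto wS).comp hwS)
  rw [show m.2 + (2 * F)⁻¹ • (B⁻¹ *ᵥ wS) = 0 from neg_add_cancel _] at this
  exact this


/-! ### Rates, sparsity and linearization of the estimates -/

/-- If the penalized estimate has a nonzero coordinate, its penalty weight is at most the
Lipschitz constant of the criterion in this coordinate. -/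
lemma IsACQREstimate.weight_le {n p K : ℕ} {τ : Fin K → ℝ} (h0 : ∀ k, 0 < τ k)
    (h1 : ∀ k, τ k < 1) {X : Matrix (Fin n) (Fin p) ℝ} {y : Fin n → ℝ} {lam : ℝ}
    {pilot β : Fin p → ℝ} (h : IsACQREstimate τ X y lam pilot β) {j : Fin p} (hj : β j ≠ 0) :
    lam ≤ K * (∑ i, |X i j|) * pilot j ^ 2 := by
  obtain ⟨hfin, b, hb⟩ := h
  have hp : pilot j ≠ 0 := fun hp => hj (hfin j hp)
  -- The competitor cancels only the coordinate `j`, which keeps the penalty finite.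
  have hb' := hb b (Function.update β j 0) fun l hl => by
    rcases eq_or_ne l j with rfl | hlj
    · simp
    · rw [Function.update_of_ne hlj]
      exact hfin l hl
  have hpen : ∑ l, |β l| / |pilot l| ^ 2 - ∑ l, |Function.update β j 0 l| / |pilot l| ^ 2 =
      |β j| / pilot j ^ 2 := by
    rw [← Finset.sum_sub_distrib, Finset.sum_eq_single j]
    · simp
    · intro l _ hl
      rw [Function.update_of_ne hl, sub_self]
    · simp
  have hloss : cqrLoss τ X y b (Function.update β j 0) - cqrLoss τ X y b β ≤
      K * (∑ i, |X i j|) * |β j| := by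
    have hc : ∀ (k : Fin K) (i : Fin n),
        checkFun (τ k) (y i - b k - ∑ l, X i l * Function.update β j 0 l) -
        checkFun (τ k) (y i - b k - ∑ l, X i l * β l) ≤ |X i j| * |β j| := by
      intro k i
      refine (abs_checkFun_sub_le (h0 k) (h1 k) _ _).trans_eq ?_
      rw [← abs_mul]
      congr 1
      rw [sub_sub_sub_cancel_left, ← Finset.sum_sub_distrib, Finset.sum_eq_single j]
      · simp
      · intro l _ hl
        rw [Function.update_of_ne hl, sub_self]
      · simp
    simp only [cqrLoss, ← Finset.sum_sub_distrib]
    refine (Finset.sum_le_sum fun k _ => Finset.sum_le_sum fun i _ => hc k i).trans_eq ?_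
    simp only [← Finset.sum_mul, Finset.sum_const, Finset.card_univ, Fintype.card_fin,
      nsmul_eq_mul, mul_assoc]
  unfold acqrLoss at hb'
  have h2 : lam * (|β j| / pilot j ^ 2) ≤ K * (∑ i, |X i j|) * |β j| := by
    rw [← hpen, mul_sub]
    linarith
  have hβ : 0 < |β j| := abs_pos.2 hj
  have hp2 : 0 < pilot j ^ 2 := sq_pos_of_ne_zero hp
  have h3 : lam * (|β j| / pilot j ^ 2) = lam / pilot j ^ 2 * |β j| := by ring
  rw [h3] at h2
  have h4 := le_of_mul_le_mul_right h2 hβ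
  rwa [div_le_iff₀ hp2] at h4

lemma exists_bound_of_tendsto_add_mulVec {α ι κ : Type*} [Fintype ι] [Fintype κ] {l : Filter α}
    {x : α → ι → ℝ} {c : ℝ} {A : Matrix ι κ ℝ} {W : α → κ → ℝ} {M : ℝ}
    (hW : ∀ᶠ q in l, ∀ j, |W q j| ≤ M) (h : Tendsto (fun q => x q + c • (A *ᵥ W q)) l (𝓝 0)) :
    ∃ R, ∀ᶠ q in l, ∀ j, |x q j| ≤ R := by
  have hc : Continuous fun z : κ → ℝ => c • (A *ᵥ z) := by fun_prop
  obtain ⟨R, hR⟩ := (isCompact_univ_pi fun _ : κ => isCompact_Icc (a := -M) (b := M))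
    |>.exists_bound_of_continuousOn hc.continuousOn
  refine ⟨1 + R, ?_⟩
  filter_upwards [hW, h.eventually (Metric.ball_mem_nhds 0 one_pos)] with q h1 h2 j
  have h3 := hR (W q) fun i _ => abs_le.1 (h1 i)
  have h4 : ‖x q + c • (A *ᵥ W q)‖ ≤ 1 := by simpa using (mem_ball_zero_iff.1 h2).le
  calc |x q j| ≤ ‖x q‖ := norm_le_pi_norm (x q) j
    _ = ‖(x q + c • (A *ᵥ W q)) - c • (A *ᵥ W q)‖ := by rw [add_sub_cancel_right]
    _ ≤ 1 + R := (norm_sub_le _ _).trans (add_le_add h4 h3)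

section estimates

variable {α : Type*} {l : Filter α} {K p : ℕ} {τ a : Fin K → ℝ}
  {X : (n : ℕ) → Matrix (Fin n) (Fin p) ℝ} {C : Matrix (Fin p) (Fin p) ℝ} {βstar : Fin p → ℝ}
  {N : α → ℕ} {e : α → ℕ → ℝ} {c : Fin K → ℝ} {M : ℝ}

/-- Root-`n` boundedness of the composite quantile regression estimate. -/
lemma exists_bound_cqr (hK : 0 < K) (hN : Tendsto N l atTop) (hc : ∀ k, 0 < c k) (hC : C.PosDef)
    (hD : ∀ u₀ u, Tendsto (fun q => lossIncrement τ a (X (N q)) βstar (e q) u₀ u -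
      (∑ k, interceptScore τ a (N q) (e q) k * u₀ k + ∑ j, coefScore τ a (X (N q)) (e q) j * u j)) l
      (𝓝 (∑ k, c k * (u₀ k ^ 2 + u ⬝ᵥ (C *ᵥ u)))))
    (hW₀ : ∀ᶠ q in l, ∀ k, |interceptScore τ a (N q) (e q) k| ≤ M)
    (hW : ∀ᶠ q in l, ∀ j, |coefScore τ a (X (N q)) (e q) j| ≤ M) {βhat : α → Fin p → ℝ}
    (hβ : ∀ᶠ q in l, IsCQREstimate τ (X (N q)) (linearResponse (X (N q)) βstar (e q)) (βhat q)) :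
    ∃ R, ∀ᶠ q in l, ∀ j, |√(N q : ℝ) * (βhat q j - βstar j)| ≤ R := by
  -- The intercepts are chosen pointwise; filter convergence asks for no measurability.
  obtain ⟨b, hb⟩ := Filter.skolem.1 hβ
  let x : α → ↥(Finset.univ : Finset (Fin p)) → ℝ := fun q j => √(N q : ℝ) * (βhat q j - βstar j)
  have hx : ∀ q, extendZero Finset.univ (x q) = √(N q : ℝ) • (βhat q - βstar) := fun q =>
    extendZero_restrict Finset.univ (u := √(N q : ℝ) • (βhat q - βstar))
      fun j hj => absurd (Finset.mem_univ j) hj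
  have h := tendsto_restricted_argmin hK hc hC hD
    (fun q => convexOn_lossIncrement τ a (X (N q)) βstar (e q)) hW₀ hW Finset.univ
    (pen := fun _ _ => 0) (fun _ => tendsto_const_nhds)
    (Eventually.of_forall fun _ => convexOn_const 0 convex_univ)
    (b := fun q => √(N q : ℝ) • (b q - a)) (x := x) (by
      filter_upwards [hb, hN.eventually_ne_atTop 0] with q h1 h2 u₀ v
      rw [hx, lossIncrement_rescaled h2, lossIncrement]
      have := h1 (a + (√(N q : ℝ))⁻¹ • u₀) (βstar + (√(N q : ℝ))⁻¹ • extendZero Finset.univ v)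
      linarith)
  obtain ⟨R, hR⟩ := exists_bound_of_tendsto_add_mulVec
    (hW.mono fun q hq (j : (Finset.univ : Finset (Fin p))) => hq j) h
  exact ⟨R, hR.mono fun q hq j => hq ⟨j, Finset.mem_univ j⟩⟩

lemma tendsto_of_root_bound (hN : Tendsto N l atTop) {βhat : α → Fin p → ℝ} {R : ℝ} {j : Fin p}
    (h : ∀ᶠ q in l, |√(N q : ℝ) * (βhat q j - βstar j)| ≤ R) :
    Tendsto (fun q => βhat q j) l (𝓝 (βstar j)) := by
  have hs : Tendsto (fun q => R / √(N q : ℝ)) l (𝓝 0) :=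
    tendsto_const_nhds.div_atTop
      (Real.tendsto_sqrt_atTop.comp (tendsto_natCast_atTop_atTop.comp hN))
  rw [tendsto_iff_norm_sub_tendsto_zero]
  refine squeeze_zero' (Eventually.of_forall fun _ => norm_nonneg _) ?_ hs
  filter_upwards [h, hN.eventually_gt_atTop 0] with q h1 h2
  have hp : 0 < √(N q : ℝ) := by positivity
  rw [le_div_iff₀ hp, Real.norm_eq_abs]
  rwa [abs_mul, abs_of_pos hp, mul_comm] at h1

/-- The penalized estimate vanishes outside of the support of the true coefficients. -/
lemma eventually_acqr_eq_zero (h0 : ∀ k, 0 < τ k) (h1 : ∀ k, τ k < 1)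
    (hN : Tendsto N l atTop)
    (hX : Tendsto (fun n : ℕ => (1 / (n : ℝ)) • ((X n)ᵀ * X n)) atTop (𝓝 C))
    {lam : ℕ → ℝ} (hlam : Tendsto lam atTop atTop) {pilot βhat : α → Fin p → ℝ} {R : ℝ}
    (hpilot : ∀ᶠ q in l, ∀ j, |√(N q : ℝ) * (pilot q j - βstar j)| ≤ R)
    {y : (q : α) → Fin (N q) → ℝ}
    (hβ : ∀ᶠ q in l, IsACQREstimate τ (X (N q)) (y q) (lam (N q)) (pilot q) (βhat q)) :
    ∀ᶠ q in l, ∀ j, βstar j = 0 → βhat q j = 0 := by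
  rw [eventually_all]
  intro j
  by_cases hj : βstar j = 0
  swap
  · exact Eventually.of_forall fun _ h => absurd h hj
  have ht := tendsto_sum_sq_of_gram hX (Pi.single j 1)
  simp only [dotProduct_mulVec_single, one_pow, one_mul] at ht
  filter_upwards [hpilot, hβ, hN.eventually_gt_atTop 0,
    hN.eventually (ht.eventually (gt_mem_nhds (lt_add_one (C j j)))),
    (hlam.comp hN).eventually_gt_atTop (K * (1 + (C j j + 1)) * R ^ 2)] with q h2 h3 h4 h5 h6 _
  by_contra hne
  have h7 := h3.weight_le h0 h1 hne
  have hn : (0 : ℝ) < N q := by positivity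
  have h8 : N q * pilot q j ^ 2 ≤ R ^ 2 := by
    have := h2 j
    rw [hj, sub_zero] at this
    have := pow_le_pow_left₀ (abs_nonneg _) this 2
    rwa [sq_abs, mul_pow, Real.sq_sqrt hn.le] at this
  have h9 : ∑ i, |X (N q) i j| ≤ N q * (1 + (C j j + 1)) := by
    have e1 : ∑ i : Fin (N q), X (N q) i j ^ 2 ≤ N q * (C j j + 1) := by
      have := h5.le
      simp only [Pi.single_apply, mul_ite, mul_one, mul_zero, Finset.sum_ite_eq',
        Finset.mem_univ, if_true, div_pow, Real.sq_sqrt hn.le] at this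
      rw [← Finset.sum_div, div_le_iff₀ hn] at this
      linarith
    have e2 : ∑ i : Fin (N q), |X (N q) i j| ≤ ∑ i : Fin (N q), (1 + X (N q) i j ^ 2) :=
      Finset.sum_le_sum fun i _ => by
        rw [← sq_abs]
        nlinarith [sq_nonneg (|X (N q) i j| - 1), abs_nonneg (X (N q) i j)]
    rw [Finset.sum_add_distrib] at e2
    simp only [Finset.sum_const, Finset.card_univ, Fintype.card_fin, nsmul_eq_mul, mul_one] at e2
    linarith
  have hC : 0 ≤ C j j := ge_of_tendsto' ht fun n => Finset.sum_nonneg fun i _ => sq_nonneg _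
  simp only [Function.comp] at h6
  have : K * (∑ i, |X (N q) i j|) * pilot q j ^ 2 ≤ K * (1 + (C j j + 1)) * R ^ 2 := by
    calc _ ≤ K * (N q * (1 + (C j j + 1))) * pilot q j ^ 2 := by gcongr
      _ = K * (1 + (C j j + 1)) * (N q * pilot q j ^ 2) := by ring
      _ ≤ _ := by gcongr
  linarith

/-- The increment of the penalty on the support `S`, in the local parametrization. -/
def penaltyIncrement (S : Finset (Fin p)) (βstar pilot : Fin p → ℝ) (lam : ℝ) (n : ℕ)
    (v : S → ℝ) : ℝ :=
  lam * ∑ j : S, (|βstar j + (√(n : ℝ))⁻¹ * v j| - |βstar j|) / |pilot j| ^ 2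

lemma convexOn_penaltyIncrement (S : Finset (Fin p)) (βstar pilot : Fin p → ℝ) {lam : ℝ}
    (hlam : 0 ≤ lam) (n : ℕ) : ConvexOn ℝ Set.univ (penaltyIncrement S βstar pilot lam n) := by
  refine ⟨convex_univ, fun v _ w _ r s hr hs hrs => ?_⟩
  simp only [penaltyIncrement, smul_eq_mul]
  rw [mul_left_comm r, mul_left_comm s, ← mul_add]
  refine mul_le_mul_of_nonneg_left ?_ hlam
  rw [Finset.mul_sum, Finset.mul_sum, ← Finset.sum_add_distrib]
  refine Finset.sum_le_sum fun j _ => ?_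
  rw [mul_div_assoc', mul_div_assoc', ← add_div]
  gcongr
  simp only [Pi.add_apply, Pi.smul_apply, smul_eq_mul]
  have e : βstar j + (√(n : ℝ))⁻¹ * (r * v j + s * w j) =
      r * (βstar j + (√(n : ℝ))⁻¹ * v j) + s * (βstar j + (√(n : ℝ))⁻¹ * w j) := by
    linear_combination βstar j * (-hrs)
  have h := abs_add_le (r * (βstar j + (√(n : ℝ))⁻¹ * v j)) (s * (βstar j + (√(n : ℝ))⁻¹ * w j))
  rw [abs_mul, abs_mul, abs_of_nonneg hr, abs_of_nonneg hs] at h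
  rw [e]
  linear_combination h + |βstar j| * hrs

lemma tendsto_penaltyIncrement (hN : Tendsto N l atTop) (S : Finset (Fin p)) {lam : ℕ → ℝ}
    (hlam : Tendsto (fun n : ℕ => lam n / √(n : ℝ)) atTop (𝓝 0)) {pilot : α → Fin p → ℝ}
    (hS : ∀ j ∈ S, βstar j ≠ 0) (hpilot : ∀ j, Tendsto (fun q => pilot q j) l (𝓝 (βstar j)))
    (v : S → ℝ) :
    Tendsto (fun q => penaltyIncrement S βstar (pilot q) (lam (N q)) (N q) v) l (𝓝 0) := by
  simp only [penaltyIncrement, Finset.mul_sum]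
  rw [← Finset.sum_const_zero (s := (Finset.univ : Finset S))]
  refine tendsto_finsetSum _ fun j _ => ?_
  have h1 : Tendsto (fun q => |lam (N q) / √(N q : ℝ)| * |v j| / |pilot q j| ^ 2) l (𝓝 0) := by
    have h2 := (((hlam.comp hN).abs.mul_const |v j|).div ((hpilot j).abs.pow 2)
      (pow_ne_zero 2 (abs_ne_zero.2 (hS j j.2))))
    rw [abs_zero, zero_mul, zero_div] at h2
    exact h2
  refine squeeze_zero_norm (fun q => ?_) h1
  have h3 := abs_abs_sub_abs_le (βstar j + (√(N q : ℝ))⁻¹ * v j) (βstar j)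
  rw [add_sub_cancel_left, abs_mul, abs_inv, abs_of_nonneg (Real.sqrt_nonneg _)] at h3
  rw [Real.norm_eq_abs, abs_mul, abs_div, abs_of_nonneg (sq_nonneg |pilot q j|), ← mul_div_assoc,
    abs_div, abs_of_nonneg (Real.sqrt_nonneg _), div_mul_eq_mul_div, mul_div_assoc _ |v j|,
    div_eq_inv_mul |v j|]
  gcongr

/-- Linearization of the penalized estimate on the support of the true coefficients. -/
lemma tendsto_acqr (hK : 0 < K) (hN : Tendsto N l atTop) (hc : ∀ k, 0 < c k) (hC : C.PosDef)
    (hD : ∀ u₀ u, Tendsto (fun q => lossIncrement τ a (X (N q)) βstar (e q) u₀ u -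
      (∑ k, interceptScore τ a (N q) (e q) k * u₀ k + ∑ j, coefScore τ a (X (N q)) (e q) j * u j)) l
      (𝓝 (∑ k, c k * (u₀ k ^ 2 + u ⬝ᵥ (C *ᵥ u)))))
    (hW₀ : ∀ᶠ q in l, ∀ k, |interceptScore τ a (N q) (e q) k| ≤ M)
    (hW : ∀ᶠ q in l, ∀ j, |coefScore τ a (X (N q)) (e q) j| ≤ M)
    {lam : ℕ → ℝ} (hlam_top : Tendsto lam atTop atTop)
    (hlam : Tendsto (fun n : ℕ => lam n / √(n : ℝ)) atTop (𝓝 0)) {pilot βhat : α → Fin p → ℝ}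
    (hpilot : ∀ j, Tendsto (fun q => pilot q j) l (𝓝 (βstar j)))
    (hzero : ∀ᶠ q in l, ∀ j, βstar j = 0 → βhat q j = 0)
    (hβ : ∀ᶠ q in l, IsACQREstimate τ (X (N q)) (linearResponse (X (N q)) βstar (e q)) (lam (N q))
      (pilot q) (βhat q)) :
    Tendsto (fun q => (fun j : coefSupport βstar => √(N q : ℝ) * (βhat q j - βstar j)) +
      (2 * ∑ k, c k)⁻¹ • ((C.submatrix (fun j : coefSupport βstar => (j : Fin p))
        (fun j : coefSupport βstar => (j : Fin p)))⁻¹ *ᵥ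
          fun j : coefSupport βstar => coefScore τ a (X (N q)) (e q) j)) l (𝓝 0) := by
  set S := coefSupport βstar with hSdef
  have hS : ∀ j ∈ S, βstar j ≠ 0 := fun j hj => by simpa [S, coefSupport] using hj
  have hS' : ∀ j ∉ S, βstar j = 0 := fun j hj => by simpa [S, coefSupport] using hj
  obtain ⟨b, hb⟩ := Filter.skolem.1 (hβ.mono fun q hq => hq.2)
  refine tendsto_restricted_argmin hK hc hC hD
    (fun q => convexOn_lossIncrement τ a (X (N q)) βstar (e q)) hW₀ hW S
    (pen := fun q => penaltyIncrement S βstar (pilot q) (lam (N q)) (N q))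
    (tendsto_penaltyIncrement hN S hlam hS hpilot) ?_ (b := fun q => √(N q : ℝ) • (b q - a)) ?_
  · filter_upwards [(hlam_top.comp hN).eventually_ge_atTop 0] with q hq
    exact convexOn_penaltyIncrement S βstar (pilot q) hq (N q)
  · have hne : ∀ᶠ q in l, ∀ j ∈ S, pilot q j ≠ 0 := by
      rw [eventually_all_finset]
      exact fun j hj => (hpilot j).eventually_ne (hS j hj)
    filter_upwards [hb, hN.eventually_ne_atTop 0, hzero, hne] with q h1 h2 h3 h4 u₀ v
    have hs : √(N q : ℝ) ≠ 0 := by positivity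
    have hx : extendZero S (fun j : S => √(N q : ℝ) * (βhat q j - βstar j)) =
        √(N q : ℝ) • (βhat q - βstar) :=
      extendZero_restrict S (u := √(N q : ℝ) • (βhat q - βstar)) fun j hj => by
        simp [h3 j (hS' j hj), hS' j hj]
    have h5 := h1 (a + (√(N q : ℝ))⁻¹ • u₀) (βstar + (√(N q : ℝ))⁻¹ • extendZero S v)
      fun j hj => by
        have hjS : j ∉ S := fun h => h4 j h hj
        simp [hS' j hjS, extendZero_of_notMem S v hjS]
    unfold acqrLoss at h5
    have hp1 : ∑ j, |βhat q j| / |pilot q j| ^ 2 = ∑ j : S, |βhat q j| / |pilot q j| ^ 2 :=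
      sum_eq_sum_coe_of_support S _ fun j hj => by simp [h3 j (hS' j hj)]
    have hp2 : ∑ j, |(βstar + (√(N q : ℝ))⁻¹ • extendZero S v) j| / |pilot q j| ^ 2 =
        ∑ j : S, |βstar j + (√(N q : ℝ))⁻¹ * v j| / |pilot q j| ^ 2 := by
      rw [sum_eq_sum_coe_of_support S _ fun j hj => by
        simp [hS' j hj, extendZero_of_notMem S v hj]]
      simp only [Pi.add_apply, Pi.smul_apply, extendZero_of_mem, smul_eq_mul]
    rw [hp1, hp2] at h5
    rw [hx, lossIncrement_rescaled h2, lossIncrement]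
    simp only [penaltyIncrement, sub_div, Finset.sum_sub_distrib, mul_sub, ← mul_assoc,
      inv_mul_cancel₀ hs, one_mul, add_sub_cancel]
    have e : ∀ j : S, (√(N q : ℝ))⁻¹ * √(N q : ℝ) * βhat q j = βhat q j := fun j => by
      rw [inv_mul_cancel₀ hs, one_mul]
    linarith

lemma eventually_coefSupport_eq (hN : Tendsto N l atTop) {βhat : α → Fin p → ℝ} {R : ℝ}
    (hzero : ∀ᶠ q in l, ∀ j, βstar j = 0 → βhat q j = 0)
    (hR : ∀ᶠ q in l, ∀ j : coefSupport βstar, |√(N q : ℝ) * (βhat q j - βstar j)| ≤ R) :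
    ∀ᶠ q in l, coefSupport (βhat q) = coefSupport βstar := by
  have hne : ∀ᶠ q in l, ∀ j ∈ coefSupport βstar, βhat q j ≠ 0 := by
    rw [eventually_all_finset]
    intro j hj
    have hj' : βstar j ≠ 0 := by simpa [coefSupport] using hj
    exact (tendsto_of_root_bound hN (hR.mono fun q hq => hq ⟨j, hj⟩)).eventually_ne hj'
  filter_upwards [hzero, hne] with q h1 h2
  ext j
  constructor
  · intro h
    simp only [coefSupport, Finset.mem_filter, Finset.mem_univ, true_and] at h ⊢
    exact fun h' => h (h1 j h')
  · intro h
    simpa [coefSupport] using h2 j h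

end estimates


section clt

variable {Ω : Type*} [MeasurableSpace Ω] {P : Measure Ω} {μ : Measure ℝ} {ε : ℕ → Ω → ℝ}

/-- Central limit theorem for weighted sums of a bounded centered function of independent and
identically distributed variables, in terms of characteristic functions. -/
lemma tendsto_charFun_weighted_sum [IsProbabilityMeasure P] [IsProbabilityMeasure μ]
    (hlaw : ∀ i, HasLaw (ε i) μ P) (hind : iIndepFun ε P)
    {g : ℝ → ℝ} (hg : Measurable g) {B : ℝ} (hB : ∀ x, |g x| ≤ B) (h0 : ∫ x, g x ∂μ = 0)
    {c : (n : ℕ) → Fin n → ℝ} {v : ℝ} (hc : Tendsto (fun n => ∑ i, c n i ^ 2) atTop (𝓝 v))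
    (hmax : ∀ δ > 0, ∀ᶠ n in atTop, ∀ i, |c n i| ≤ δ) :
    Tendsto (fun n => charFun (P.map fun ω => ∑ i : Fin n, c n i * g (ε i ω)) 1) atTop
      (𝓝 (Complex.exp (-((∫ x, g x ^ 2 ∂μ) * v / 2 : ℝ)))) := by
  have hν : IsProbabilityMeasure (μ.map g) := Measure.isProbabilityMeasure_map hg.aemeasurable
  have h2 : MemLp id 2 (μ.map g) := by
    rw [memLp_map_measure_iff aestronglyMeasurable_id hg.aemeasurable]
    exact MemLp.of_bound hg.aestronglyMeasurable B (Eventually.of_forall hB)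
  have hm : ∫ x, x ∂(μ.map g) = 0 := by
    rw [integral_map (f := fun x => x) hg.aemeasurable aestronglyMeasurable_id]
    exact h0
  have hv : ∫ x, x ^ 2 ∂(μ.map g) = ∫ x, g x ^ 2 ∂μ :=
    integral_map hg.aemeasurable (Measurable.aestronglyMeasurable (by fun_prop))
  have h := tendsto_prod_charFun h2 hm hc hmax
  rw [hv] at h
  refine h.congr fun n => ?_
  have hae : ∀ i : Fin n, AEMeasurable (fun ω => g (ε i ω)) P := fun i =>
    hg.comp_aemeasurable (hlaw i).aemeasurable
  have hind' : iIndepFun (fun (i : Fin n) ω => c n i * g (ε i ω)) P :=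
    (hind.precomp Fin.val_injective).comp (fun i x => c n i * g x) fun i => by fun_prop
  rw [hind'.charFun_map_fun_sum_eq_prod fun i => (hae i).const_mul _, Finset.prod_apply]
  refine Finset.prod_congr rfl fun i _ => ?_
  rw [charFun_map_mul_comp (hae i), mul_one]
  congr 1
  rw [← (hlaw i).map_eq]
  exact AEMeasurable.map_map_of_aemeasurable hg.aemeasurable (hlaw i).aemeasurable

variable {K p : ℕ} {τ a : Fin K → ℝ} {X : (n : ℕ) → Matrix (Fin n) (Fin p) ℝ}
  {C : Matrix (Fin p) (Fin p) ℝ}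

lemma aemeasurable_coefScore (hlaw : ∀ i, HasLaw (ε i) μ P) (n : ℕ) (j : Fin p) :
    AEMeasurable (fun ω => coefScore τ a (X n) (fun i => ε i ω) j) P := by
  unfold coefScore
  refine AEMeasurable.const_mul ?_ _
  refine Finset.aemeasurable_fun_sum _ fun i _ => AEMeasurable.const_mul ?_ _
  exact measurable_totalScore.comp_aemeasurable (hlaw i).aemeasurable

/-- Asymptotic normality of the linearization of the estimate. -/
lemma tendstoInDistribution_coefScore [IsProbabilityMeasure P] [IsProbabilityMeasure μ]
    (h0 : ∀ k, 0 < τ k) (h1 : ∀ k, τ k < 1)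
    (ha : ∀ k, cdf μ (a k) = τ k) (hlaw : ∀ i, HasLaw (ε i) μ P) (hind : iIndepFun ε P)
    (hC : C.PosDef)
    (hX : Tendsto (fun n : ℕ => (1 / (n : ℝ)) • ((X n)ᵀ * X n)) atTop (𝓝 C))
    (hmax : ∀ j, ∀ δ > 0, ∀ᶠ n : ℕ in atTop, ∀ i, |X n i j / √(n : ℝ)| ≤ δ)
    (S : Finset (Fin p)) (F : ℝ) :
    TendstoInDistribution
      (fun (n : ℕ) (ω : Ω) => (WithLp.toLp 2 (-(F⁻¹ •
        ((C.submatrix (fun j : S => (j : Fin p)) (fun j : S => (j : Fin p)))⁻¹ *ᵥ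
          fun j : S => coefScore τ a (X n) (fun i => ε i ω) j))) : EuclideanSpace ℝ S))
      atTop id (fun _ => P)
      (multivariateGaussian 0
        (((∑ k, ∑ k', min (τ k) (τ k') * (1 - max (τ k) (τ k'))) / F ^ 2) •
          (C.submatrix (fun j : S => (j : Fin p)) (fun j : S => (j : Fin p)))⁻¹)) := by
  set B := C.submatrix (fun j : S => (j : Fin p)) (fun j : S => (j : Fin p)) with hBdef
  have hB : B.PosDef := hC.submatrix Subtype.val_injective
  have hdet : IsUnit B.det := hB.det_pos.ne'.isUnit
  have hsym : (B⁻¹)ᵀ = B⁻¹ := by simpa [Matrix.IsHermitian] using hB.inv.isHermitian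
  rw [← integral_totalScore_sq ha]
  set V := ∫ x, totalScore τ a x ^ 2 ∂μ with hV
  have hV0 : 0 ≤ V := integral_nonneg fun x => sq_nonneg _
  have hcov : ((V / F ^ 2) • B⁻¹).PosSemidef := hB.inv.posSemidef.smul (by positivity)
  set Y : ℕ → Ω → EuclideanSpace ℝ S := fun n ω => WithLp.toLp 2 (-(F⁻¹ •
    (B⁻¹ *ᵥ fun j : S => coefScore τ a (X n) (fun i => ε i ω) j))) with hY
  have hmeas : ∀ n, AEMeasurable (Y n) P := by
    intro n
    have hc₀ : Continuous fun z : S → ℝ => -(F⁻¹ • (B⁻¹ *ᵥ z)) := by fun_prop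
    have hc := (PiLp.continuous_toLp 2 fun _ : S => ℝ).comp hc₀
    have hscore : AEMeasurable
        (fun ω => fun j : S => coefScore τ a (X n) (fun i => ε i ω) j) P :=
      aemeasurable_pi_lambda _ fun j => aemeasurable_coefScore (X := X) hlaw n j
    exact hc.measurable.comp_aemeasurable hscore
  refine ⟨hmeas, aemeasurable_id, ?_⟩
  refine ProbabilityMeasure.tendsto_iff_tendsto_charFun.2 fun t => ?_
  simp only [ProbabilityMeasure.coe_mk, Measure.map_id]
  rw [charFun_multivariateGaussian hcov]
  set d : S → ℝ := -(F⁻¹ • (B⁻¹ *ᵥ t.ofLp)) with hd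
  have hlin : ∀ n ω, inner ℝ (Y n ω) t =
      ∑ i : Fin n, (0 + ∑ j, X n i j * extendZero S d j) / √(n : ℝ) * totalScore τ a (ε i ω) := by
    intro n ω
    have e1 : inner ℝ (Y n ω) t =
        (fun j : S => coefScore τ a (X n) (fun i => ε i ω) j) ⬝ᵥ d := by
      rw [EuclideanSpace.inner_eq_star_dotProduct]
      simp only [hY, hd, star_trivial, dotProduct_neg, dotProduct_smul]
      rw [Matrix.dotProduct_mulVec, ← Matrix.mulVec_transpose, hsym, dotProduct_comm]
    rw [e1, ← dotProduct_extendZero]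
    simp only [coefScore, Finset.mul_sum, Finset.sum_mul, zero_add, Finset.sum_div]
    rw [Finset.sum_comm]
    refine Finset.sum_congr rfl fun i _ => Finset.sum_congr rfl fun j _ => ?_
    ring
  have hchar : ∀ n, charFun (P.map (Y n)) t = charFun (P.map fun ω => ∑ i : Fin n,
      (0 + ∑ j, X n i j * extendZero S d j) / √(n : ℝ) * totalScore τ a (ε i ω)) 1 := by
    intro n
    rw [charFun_apply, charFun_apply_real, integral_map (hmeas n) (by fun_prop), integral_map]
    · simp only [hlin, Complex.ofReal_one, one_mul]
    · refine Finset.aemeasurable_fun_sum _ fun i _ => AEMeasurable.const_mul ?_ _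
      exact measurable_totalScore.comp_aemeasurable (hlaw i).aemeasurable
    · fun_prop
  have hsum : Tendsto (fun n => ∑ i : Fin n,
      ((0 + ∑ j, X n i j * extendZero S d j) / √(n : ℝ)) ^ 2) atTop (𝓝 (d ⬝ᵥ (B *ᵥ d))) := by
    rw [← extendZero_quadratic]
    simpa only [zero_add] using tendsto_sum_sq_of_gram hX (extendZero S d)
  have h := tendsto_charFun_weighted_sum hlaw hind measurable_totalScore
    (abs_totalScore_le h0 h1) (integral_totalScore ha) hsum
    (fun δ hδ => eventually_abs_lin_le hmax 0 (extendZero S d) hδ)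
  simp only [hchar]
  convert! h using 2
  have hq : d ⬝ᵥ (B *ᵥ d) = (F ^ 2)⁻¹ * (t.ofLp ⬝ᵥ (B⁻¹ *ᵥ t.ofLp)) := by
    simp only [hd, Matrix.mulVec_neg, Matrix.mulVec_smul, Matrix.mulVec_mulVec,
      Matrix.mul_nonsing_inv _ hdet, Matrix.one_mulVec, dotProduct_neg, neg_dotProduct,
      dotProduct_smul, smul_dotProduct, smul_eq_mul]
    rw [dotProduct_comm]
    ring
  rw [hq, inner_zero_right]
  simp only [Matrix.smul_mulVec, dotProduct_smul, smul_eq_mul, Complex.ofReal_zero, zero_mul,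
    zero_sub]
  congr 2
  push_cast
  ring

end clt

end

theorem theorem4p1
    {p K : ℕ} (hK : 0 < K)
    -- the quantile levels `0 < τ₁ < ⋯ < τ_K < 1`
    (τ : Fin K → ℝ) (hτ_mono : StrictMono τ) (hτ_pos : ∀ k, 0 < τ k) (hτ_lt : ∀ k, τ k < 1)
    -- i.i.d. errors with a nowhere vanishing density `f`
    {Ω : Type*} [MeasurableSpace Ω] (P : Measure Ω) [IsProbabilityMeasure P]
    (f : ℝ → ℝ) (hf_meas : Measurable f) (hf_pos : ∀ t, 0 < f t)
    (ε : ℕ → Ω → ℝ) (hε_law : ∀ i, HasLaw (ε i) (densityLaw f) P) (hε_indep : iIndepFun ε P)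
    -- the design matrix of each sample size and the true coefficients
    (X : (n : ℕ) → Matrix (Fin n) (Fin p) ℝ) (βstar : Fin p → ℝ)
    -- the limit of the Gram matrices
    (C : Matrix (Fin p) (Fin p) ℝ) (hC : C.PosDef)
    (hX : Tendsto (fun n : ℕ => (1 / (n : ℝ)) • ((X n)ᵀ * X n)) atTop (𝓝 C))
    -- the local behaviour of the distribution function at the error quantiles
    (hF : ∀ (k : Fin K) (u₀ : ℝ) (u : Fin p → ℝ),
      Tendsto
        (fun n : ℕ => (1 / (n : ℝ)) * ∑ i : Fin n, ∫ t in (0 : ℝ)..(u₀ + ∑ j, X n i j * u j),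
          √(n : ℝ) * (cdf (densityLaw f) (quantile (densityLaw f) (τ k) + t / √(n : ℝ))
            - cdf (densityLaw f) (quantile (densityLaw f) (τ k))))
        atTop
        (𝓝 (1 / 2 * f (quantile (densityLaw f) (τ k)) * (u₀ ^ 2 + u ⬝ᵥ (C *ᵥ u)))))
    -- the penalization parameters
    (lam : ℕ → ℝ) (hlam_top : Tendsto lam atTop atTop)
    (hlam_sqrt : Tendsto (fun n : ℕ => lam n / √(n : ℝ)) atTop (𝓝 0))
    -- the two estimators, as random vectors
    (βcqr βacqr : ℕ → Ω → Fin p → ℝ)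
    (hcqr_meas : ∀ n, AEMeasurable (βcqr n) P) (hacqr_meas : ∀ n, AEMeasurable (βacqr n) P)
    (hcqr : ∀ᶠ n in atTop, ∀ᵐ ω ∂P,
      IsCQREstimate τ (X n) (linearResponse (X n) βstar fun i => ε i ω) (βcqr n ω))
    (hacqr : ∀ᶠ n in atTop, ∀ᵐ ω ∂P,
      IsACQREstimate τ (X n) (linearResponse (X n) βstar fun i => ε i ω) (lam n)
        (βcqr n ω) (βacqr n ω)) :
    -- consistency in selection
    Tendsto (fun n => P {ω | coefSupport (βacqr n ω) = coefSupport βstar}) atTop (𝓝 1) ∧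
    -- asymptotic normality
    TendstoInDistribution
      (fun (n : ℕ) (ω : Ω) => (WithLp.toLp 2 fun j : coefSupport βstar =>
        √(n : ℝ) * (βacqr n ω j - βstar j) : EuclideanSpace ℝ (coefSupport βstar)))
      atTop id (fun _ => P)
      (multivariateGaussian 0 (cqrOracleCov τ f C (coefSupport βstar))) := by
  have hprob : IsProbabilityMeasure (densityLaw f) :=
    (hε_law 0).map_eq ▸ Measure.isProbabilityMeasure_map (hε_law 0).aemeasurable
  set a : Fin K → ℝ := fun k => quantile (densityLaw f) (τ k) with ha_def
  set c : Fin K → ℝ := fun k => 1 / 2 * f (a k) with hc_def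
  have ha : ∀ k, cdf (densityLaw f) (a k) = τ k := fun k => cdf_quantile (hτ_pos k) (hτ_lt k)
  have hc : ∀ k, 0 < c k := fun k => mul_pos (by norm_num) (hf_pos _)
  have hF' := fun k => tendsto_sum_meanKnight (hF k)
  have hmax : ∀ j, ∀ δ > 0, ∀ᶠ n : ℕ in atTop, ∀ i, |X n i j / √(n : ℝ)| ≤ δ := fun j δ hδ =>
    eventually_abs_design_le (hc ⟨0, hK⟩) hX (hF' ⟨0, hK⟩) j hδ
  have hsum : 2 * ∑ k, c k = ∑ k, f (a k) := by
    rw [Finset.mul_sum]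
    exact Finset.sum_congr rfl fun k _ => by simp only [hc_def]; ring
  have hD := tendsto_whp_lossIncrement (τ := τ) (c := c) hε_law hε_indep hmax hF' βstar
  have hcqr' := eventually_whp_of_ae hcqr
  have hacqr' := eventually_whp_of_ae hacqr
  set S := coefSupport βstar with hS
  set A := (C.submatrix (fun j : S => (j : Fin p)) (fun j : S => (j : Fin p)))⁻¹ with hA
  have key : ∀ l ≤ whp P, ∀ M : ℝ,
      (∀ᶠ q : ℕ × Ω in l, ∀ k, |interceptScore τ a q.1 (fun i => ε i q.2) k| ≤ M) →
      (∀ᶠ q : ℕ × Ω in l, ∀ j, |coefScore τ a (X q.1) (fun i => ε i q.2) j| ≤ M) →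
      (∀ᶠ q : ℕ × Ω in l, coefSupport (βacqr q.1 q.2) = S) ∧
      Tendsto (fun q : ℕ × Ω => (fun j : S => √(q.1 : ℝ) * (βacqr q.1 q.2 j - βstar j)) +
        (∑ k, f (a k))⁻¹ • (A *ᵥ fun j : S => coefScore τ a (X q.1) (fun i => ε i q.2) j)) l
        (𝓝 0) := by
    intro l hl M hW₀ hW
    have hN : Tendsto Prod.fst l atTop := tendsto_fst_whp.mono_left hl
    have hD' := fun u₀ u => (hD u₀ u).mono_left hl
    obtain ⟨R, hR⟩ := exists_bound_cqr (N := Prod.fst) (e := fun q i => ε i q.2) hK hN hc hC hD'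
      hW₀ hW (hcqr'.filter_mono hl)
    have hzero := eventually_acqr_eq_zero (N := Prod.fst) hτ_pos hτ_lt hN hX hlam_top hR
      (hacqr'.filter_mono hl)
    have hlim := tendsto_acqr (N := Prod.fst) (e := fun q i => ε i q.2) hK hN hc hC hD' hW₀ hW
      hlam_top hlam_sqrt (fun j => tendsto_of_root_bound hN (hR.mono fun q hq => hq j)) hzero
      (hacqr'.filter_mono hl)
    rw [hsum] at hlim
    obtain ⟨R', hR'⟩ := exists_bound_of_tendsto_add_mulVec
      (hW.mono fun q hq (j : S) => hq j) hlim
    exact ⟨eventually_coefSupport_eq hN hzero hR', hlim⟩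
  refine ⟨tendsto_measure_of_whp (p := fun n ω => coefSupport (βacqr n ω) = S)
    (mem_whp_of_forall_scores_bounded hτ_pos hτ_lt ha hε_law hε_indep hX
      fun l hl M h1 h2 => (key l hl M h1 h2).1), ?_⟩
  have hclt := tendstoInDistribution_coefScore hτ_pos hτ_lt ha hε_law hε_indep hC hX hmax S
    (∑ k, f (a k))
  refine tendstoInDistribution_of_tendstoInMeasure_sub _ _ hclt ?_ fun n => ?_
  · rw [tendstoInMeasure_iff_norm]
    intro r hr
    have h : ∀ᶠ q in whp P, ‖(WithLp.toLp 2 ((fun j : S =>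
        √(q.1 : ℝ) * (βacqr q.1 q.2 j - βstar j)) + (∑ k, f (a k))⁻¹ •
          (A *ᵥ fun j : S => coefScore τ a (X q.1) (fun i => ε i q.2) j)) :
            EuclideanSpace ℝ S)‖ < r := by
      refine mem_whp_of_forall_scores_bounded hτ_pos hτ_lt ha hε_law hε_indep hX
        fun l hl M h1 h2 => ?_
      have h3 := (((PiLp.continuous_toLp 2 fun _ : S => ℝ).tendsto 0).comp
        (key l hl M h1 h2).2).norm
      rw [WithLp.toLp_zero, norm_zero] at h3
      exact h3.eventually (gt_mem_nhds hr)
    refine (mem_whp.1 h).congr fun n => ?_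
    congr 1
    ext ω
    simp only [Set.mem_ofPred_eq, not_lt, Pi.sub_apply, Pi.zero_apply, sub_zero,
      ← WithLp.toLp_sub, sub_neg_eq_add]
    exact Iff.rfl
  · refine (PiLp.continuous_toLp 2 fun _ : S => ℝ).measurable.comp_aemeasurable
      (aemeasurable_pi_lambda _ fun j => ?_)
    exact (((measurable_pi_apply (j : Fin p)).comp_aemeasurable (hacqr_meas n)).sub_const
      _).const_mul _
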